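/- Let $\mathbb E$ be a finite-dimensional real inner product space, $X\subseteq\mathbb E$ closed and convex with nonempty interior, and $F:\mathbb E\to\mathbb E$ continuously differentiable. $VI(X,F)$ asks for $x\in X$ with $\langle F(x),y-x\rangle\ge 0$ for all $y\in X$. The space $\mathbb E\times\mathbb E$ carries the Euclidean norm $\|(x,y)\|=\sqrt{\|x\|^2+\|y\|^2}$. **Smoothing.** Let $f:\operatorname{int}X\to\mathbb R$ be a $\vartheta$-self-concordant barrier of $X$: $f$ is $C^3$; $f(x_j)\to\infty$ whenever $x_j\in\operatorname{int}X$ converges to a boundary point of $X$; the number $\vartheta=\inf\{t\ge0:\ t\,D^2f(x)[h,h]-(Df(x)[h])^2\ge0\ \ \forall x\in\operatorname{int}X,\ h\in\mathbb E\}$ is finite; and $|D^3f(x)[h,h,h]|\le 2(D^2f(x)[h,h])^{3/2}$ for all $x\in \operatorname{int}X$, $h\in\mathbb E$. For $\mu>0$ let $p_\mu(z)$ be the point $u\in\operatorname{int}X$ with $u+\mu^2\nabla f(u)=z$, and let $p_0(z)=\Pi_X(z)$ be the Euclidean projection. For $w=(x,y)\in\mathbb E\times\mathbb E$ put $\phi_\mu(w)=x-p_\mu(x-y)$,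 $H_\mu(w)=(\phi_\mu(w),F(x)-y)$, $\Psi_\mu(w)=\|F(x)-y\|+\|\phi_\mu(w)\|$ and $\mathcal N(\beta,\mu)=\{w:\Psi_\mu(w)\le\beta\mu\}$. **Algorithm.** Given are $\sigma,\alpha_1,\alpha_2,\alpha_3\in(0,1)$ and sequences $\theta_1^{(k)},\theta_2^{(k)}\in(0,1)$ with $\sigma+\sqrt2\sup_k\theta_1^{(k)}<1$. *Step 0.* Choose $\mu_0>0$, $\beta>\sqrt\vartheta$ and $w^{(0)}\in\mathcal N(\beta,\mu_0)$; set $k=0$. *Step 1.* If $H_0(w^{(k)})=0$, terminate. Otherwise, if $\Psi_{\mu_k}(w^{(k)})=0$, set $\tilde w^{(k+1)}=w^{(k)}$ and go to Step 3; else choose $\Delta\tilde w^{(k)},r_1^{(k)}$ with $-H_{\mu_k}(w^{(k)})+r_1^{(k)}=DH_{\mu_k}(w^{(k)})[\Delta\tilde w^{(k)}]$ and $\|r_1^{(k)}\|\le\theta_1^{(k)}\|H_{\mu_k}(w^{(k)})\|$. *Step 2.* Let $\lambda_k$ be the maximum of $1,\alpha_1,\alpha_1^2,\dots$ such that $\Psi_{\mu_k}(w^{(k)}+\lambda_k\Delta\tilde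 w^{(k)})\le(1-\sigma\lambda_k)\Psi_{\mu_k}(w^{(k)})$, and set $\tilde w^{(k+1)}=w^{(k)}+\lambda_k\Delta\tilde w^{(k)}$. *Step 3.* Let $\gamma_k$ be the maximum of $1,\alpha_2,\alpha_2^2,\dots$ such that $\tilde w^{(k+1)}\in\mathcal N(\beta,(1-\gamma_k)\mu_k)$, and set $\tilde\mu_{k+1}=(1-\gamma_k)\mu_k$. *Step 4.* Choose $\Delta\hat w^{(k)},r_2^{(k)}$ with $-H_0(w^{(k)})+r_2^{(k)}=DH_{\mu_k}(w^{(k)})[\Delta\hat w^{(k)}]$ and $\|r_2^{(k)}\|\le\theta_2^{(k)}\|H_0(w^{(k)})\|$; set $\hat w^{(k+1)}=w^{(k)}+\Delta\hat w^{(k)}$. *Step 5.* If $\hat w^{(k+1)}\notin\mathcal N(\beta,\tilde\mu_{k+1})$, set $\mu_{k+1}=\tilde\mu_{k+1}$, $w^{(k+1)}=\tilde w^{(k+1)}$. Otherwise, if $H_0(\hat w^{(k+1)})=0$, terminate; else let $\eta_k$ be the maximum of $1,\alpha_3,\alpha_3^2,\dots$ such that $\hat w^{(k+1)}\notin\mathcal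 N(\beta,\eta_k\alpha_3\tilde\mu_{k+1})$ and set $\mu_{k+1}=\eta_k\tilde\mu_{k+1}$, $w^{(k+1)}=\hat w^{(k+1)}$. Increase $k$ by one and return to Step 1. **Theorem.** Consider a run of the algorithm, finite or infinite, and suppose: 1. there is a constant $C$ such that, for every completed iteration $k$, $DH_{\mu_k}(w^{(k)})$ is nonsingular and $\|DH_{\mu_k}(w^{(k)})^{-1}\|\le C$; 2. $\|F(y)-F(x)-DF(x)[y-x]\|=o(\|y-x\|)$ uniformly in $x,y\in\mathbb E$, i.e. for every $\varepsilon>0$ there is $\delta>0$ such that the left side is at most $\varepsilon\|y-x\|$ whenever $\|y-x\|<\delta$. Then in every completed iteration the maxima defining $\lambda_k$, $\gamma_k$, $\eta_k$ exist whenever they are called for, and every $v=(x,y)$ with $H_0(v)=0$ (in particular a point at which the algorithm terminates) satisfies $y=F(x)$ with $x$ a solution of $VI(X,F)$. Moreover: (i) There is $\bar\lambda\in(0,1]$ such that, with $\bar\gamma=\min\{1,\ \beta\sigma\bar\lambda/(\beta+\sqrt\vartheta)\}$, every completed iteration $k$ satisfies $\lambda_k\ge\alpha_1\bar\lambda$ (if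 a line search is performed), $\gamma_k\ge\alpha_2\bar\gamma$ and $\mu_{k+1}\le(1-\alpha_2\bar\gamma)\mu_k$; consequently $\mu_k\le\mu_0(1-\alpha_2\bar\gamma)^k$ for all $k$ reached. If the run is infinite, then: (ii) $H_0(w^{(k)})\to0$ R-linearly, i.e. there are $M$ and $\rho\in(0,1)$ with $\|H_0(w^{(k)})\|\le M\rho^k$ for all $k\ge 0$; (iii) $(w^{(k)})_{k\ge0}$ is a Cauchy sequence and converges to some $w^*=(x^*,y^*)$ such that $x^*$ solves $VI(X,F)$ and $y^*=F(x^*)$. -/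

import Mathlib

open Filter Topology

noncomputable section

namespace NICM

/-- Finite-dimensional real normed spaces are complete (needed for gradients). -/
instance instCompleteSpaceOfFiniteDimensional {E : Type*} [NormedAddCommGroup E]
    [NormedSpace ℝ E] [FiniteDimensional ℝ E] : CompleteSpace E :=
  FiniteDimensional.complete ℝ E

/-- `E × E` with the Euclidean norm `‖(x, y)‖ = √(‖x‖² + ‖y‖²)`. -/
abbrev Pair (E : Type*) : Type _ := WithLp 2 (E × E)

section Problem

variable {E : Type*} [NormedAddCommGroup E] [InnerProductSpace ℝ E]

/-- `x` solves the variational inequality `VI(X, F)`. -/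
def SolvesVI (X : Set E) (F : E → E) (x : E) : Prop :=
  x ∈ X ∧ ∀ y ∈ X, 0 ≤ inner ℝ (F x) (y - x)

/-- `f` (of which only the values on `interior X` matter) is a barrier of `X`. -/
def IsBarrier (X : Set E) (f : E → ℝ) : Prop :=
  ∀ u : ℕ → E, (∀ n, u n ∈ interior X) →
    ∀ x ∈ frontier X, Tendsto u atTop (𝓝 x) → Tendsto (fun n => f (u n)) atTop atTop

/-- `f` is a self-concordant barrier of `X` with barrier parameter `ϑ`.
The set in `parameter` is nonempty, i.e. the parameter is finite, since the empty set has no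
greatest lower bound in `ℝ`. -/
structure IsSelfConcordantBarrier (ϑ : ℝ) (X : Set E) (f : E → ℝ) : Prop where
  barrier : IsBarrier X f
  contDiffOn : ContDiffOn ℝ 3 f (interior X)
  parameter : IsGLB {t : ℝ | 0 ≤ t ∧ ∀ x ∈ interior X, ∀ h : E,
    0 ≤ t * iteratedFDeriv ℝ 2 f x (fun _ => h) - (fderiv ℝ f x h) ^ 2} ϑ
  concordant : ∀ x ∈ interior X, ∀ h : E,
    |iteratedFDeriv ℝ 3 f x (fun _ => h)| ≤
      2 * (iteratedFDeriv ℝ 2 f x (fun _ => h)) ^ (3 / 2 : ℝ)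

/-- The Euclidean projection of `z` onto `X`: the minimizer of `‖x - z‖` over `x ∈ X`. -/
def proj (X : Set E) (z : E) : E :=
  Classical.epsilon fun x => x ∈ X ∧ ∀ v ∈ X, ‖x - z‖ ≤ ‖v - z‖

variable [FiniteDimensional ℝ E]

/-- The barrier-based smoothing approximation `p_μ(z)` of the projection onto `X`: for `μ > 0`
the point `u ∈ interior X` with `u + μ² ∇f(u) = z`, and the projection of `z` for `μ = 0`
(negative `μ` are never used). -/
def smoothProj (X : Set E) (f : E → ℝ) (μ : ℝ) (z : E) : E :=
  open Classical in
  if 0 < μ then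
    Classical.epsilon fun u => u ∈ interior X ∧ u + μ ^ 2 • gradient f u = z
  else proj X z

/-- `φ_μ(x, y) = x - p_μ(x - y)`. -/
def phi (X : Set E) (f : E → ℝ) (μ : ℝ) (w : Pair E) : E :=
  w.fst - smoothProj X f μ (w.fst - w.snd)

/-- `H_μ(x, y) = (x - p_μ(x - y), F(x) - y)`. -/
def H (X : Set E) (f : E → ℝ) (F : E → E) (μ : ℝ) (w : Pair E) : Pair E :=
  WithLp.toLp 2 (phi X f μ w, F w.fst - w.snd)

/-- The merit function `Ψ_μ(x, y) = ‖F(x) - y‖ + ‖φ_μ(x, y)‖`. -/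
def merit (X : Set E) (f : E → ℝ) (F : E → E) (μ : ℝ) (w : Pair E) : ℝ :=
  ‖F w.fst - w.snd‖ + ‖phi X f μ w‖

/-- The neighbourhood `𝒩(β, μ) = {w : Ψ_μ(w) ≤ β μ}`. -/
def nbhd (X : Set E) (f : E → ℝ) (F : E → E) (β μ : ℝ) : Set (Pair E) :=
  {w | merit X f F μ w ≤ β * μ}

end Problem

section Algorithm

/-- The parameters of the method. -/
structure Params where
  σ : ℝ
  α₁ : ℝ
  α₂ : ℝ
  α₃ : ℝ
  θ₁ : ℕ → ℝ
  θ₂ : ℕ → ℝ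
  β : ℝ
  σ_mem : σ ∈ Set.Ioo (0 : ℝ) 1
  α₁_mem : α₁ ∈ Set.Ioo (0 : ℝ) 1
  α₂_mem : α₂ ∈ Set.Ioo (0 : ℝ) 1
  α₃_mem : α₃ ∈ Set.Ioo (0 : ℝ) 1
  θ₁_mem : ∀ k, θ₁ k ∈ Set.Ioo (0 : ℝ) 1
  θ₂_mem : ∀ k, θ₂ k ∈ Set.Ioo (0 : ℝ) 1
  σ_add_lt : σ + √2 * (⨆ k, θ₁ k) < 1

/-- The maximum of the values `1, α, α², …` (with `0 < α < 1`) that satisfy `Q`.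
If no value satisfies `Q` the result is `1`; that this never occurs in the algorithm is part of
the theorem. -/
def maxPower (α : ℝ) (Q : ℝ → Prop) : ℝ := α ^ sInf {j : ℕ | Q (α ^ j)}

/-- The quantities computed by the method. Index `k` refers to the `k`-th iteration, so that
`wTilde k`, `muTilde k`, `wHat k` stand for `w̃⁽ᵏ⁺¹⁾`, `μ̃ₖ₊₁`, `ŵ⁽ᵏ⁺¹⁾`. -/
structure Trace (E : Type*) where
  w : ℕ → Pair E
  mu : ℕ → ℝ
  r₁ : ℕ → Pair E
  dTilde : ℕ → Pair E
  lam : ℕ → ℝ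
  wTilde : ℕ → Pair E
  gam : ℕ → ℝ
  muTilde : ℕ → ℝ
  r₂ : ℕ → Pair E
  dHat : ℕ → Pair E
  wHat : ℕ → Pair E
  eta : ℕ → ℝ

variable {E : Type*} [NormedAddCommGroup E] [InnerProductSpace ℝ E] [FiniteDimensional ℝ E]

/-- The criterion of the line search (Step 2) for the step length `l`. -/
def LineSearchCrit (X : Set E) (f : E → ℝ) (F : E → E) (P : Params) (T : Trace E) (k : ℕ)
    (l : ℝ) : Prop :=
  merit X f F (T.mu k) (T.w k + l • T.dTilde k) ≤ (1 - P.σ * l) * merit X f F (T.mu k) (T.w k)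

/-- The criterion of the reduction of `μ` (Step 3) for the value `g`. -/
def ReductionCrit (X : Set E) (f : E → ℝ) (F : E → E) (P : Params) (T : Trace E) (k : ℕ)
    (g : ℝ) : Prop :=
  T.wTilde k ∈ nbhd X f F P.β ((1 - g) * T.mu k)

/-- The criterion of the further reduction of `μ` (Step 5) for the value `e`. -/
def NewtonReductionCrit (X : Set E) (f : E → ℝ) (F : E → E) (P : Params) (T : Trace E) (k : ℕ)
    (e : ℝ) : Prop :=
  T.wHat k ∉ nbhd X f F P.β (e * P.α₃ * T.muTilde k)

/-- Iteration `k` of the method is carried out in full (without termination) and yields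
`w⁽ᵏ⁺¹⁾` and `μₖ₊₁`. -/
structure IsIteration (X : Set E) (f : E → ℝ) (F : E → E) (P : Params) (T : Trace E) (k : ℕ) :
    Prop where
  /-- Step 1: no termination. -/
  not_terminated₁ : H X f F 0 (T.w k) ≠ 0
  /-- Step 1: the case in which no centering step is needed. -/
  centering_trivial : merit X f F (T.mu k) (T.w k) = 0 → T.wTilde k = T.w k
  /-- Step 1: the inexact Newton equation of the centering step. -/
  centering_eq : merit X f F (T.mu k) (T.w k) ≠ 0 →
    -H X f F (T.mu k) (T.w k) + T.r₁ k
      = fderiv ℝ (H X f F (T.mu k)) (T.w k) (T.dTilde k)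
  centering_residual : merit X f F (T.mu k) (T.w k) ≠ 0 →
    ‖T.r₁ k‖ ≤ P.θ₁ k * ‖H X f F (T.mu k) (T.w k)‖
  /-- Step 2: line search. -/
  line_search : merit X f F (T.mu k) (T.w k) ≠ 0 →
    T.lam k = maxPower P.α₁ (LineSearchCrit X f F P T k)
  centering_update : merit X f F (T.mu k) (T.w k) ≠ 0 →
    T.wTilde k = T.w k + T.lam k • T.dTilde k
  /-- Step 3: reduction of `μ`. -/
  reduction : T.gam k = maxPower P.α₂ (ReductionCrit X f F P T k)
  muTilde_eq : T.muTilde k = (1 - T.gam k) * T.mu k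
  /-- Step 4: the inexact Newton equation of the approximate Newton step. -/
  newton_eq : -H X f F 0 (T.w k) + T.r₂ k
      = fderiv ℝ (H X f F (T.mu k)) (T.w k) (T.dHat k)
  newton_residual : ‖T.r₂ k‖ ≤ P.θ₂ k * ‖H X f F 0 (T.w k)‖
  wHat_eq : T.wHat k = T.w k + T.dHat k
  /-- Step 5: the approximate Newton step is rejected. -/
  rejected : T.wHat k ∉ nbhd X f F P.β (T.muTilde k) →
    T.mu (k + 1) = T.muTilde k ∧ T.w (k + 1) = T.wTilde k
  /-- Step 5: no termination. -/
  not_terminated₅ : T.wHat k ∈ nbhd X f F P.β (T.muTilde k) → H X f F 0 (T.wHat k) ≠ 0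
  /-- Step 5: the approximate Newton step is accepted. -/
  newton_reduction : T.wHat k ∈ nbhd X f F P.β (T.muTilde k) →
    T.eta k = maxPower P.α₃ (NewtonReductionCrit X f F P T k)
  accepted : T.wHat k ∈ nbhd X f F P.β (T.muTilde k) →
    T.mu (k + 1) = T.eta k * T.muTilde k ∧ T.w (k + 1) = T.wHat k

/-- `T` records a run of the method in which (at least) `N` iterations are carried out in full;
`N = ⊤` means that the run is infinite. -/
structure IsRun (ϑ : ℝ) (X : Set E) (f : E → ℝ) (F : E → E) (P : Params) (T : Trace E)
    (N : ℕ∞) : Prop where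
  mu_zero_pos : 0 < T.mu 0
  sqrt_lt_beta : √ϑ < P.β
  w_zero_mem : T.w 0 ∈ nbhd X f F P.β (T.mu 0)
  iteration : ∀ k : ℕ, (k : ℕ∞) < N → IsIteration X f F P T k

/-- First assumption: the derivatives `D H_{μ_k}(w⁽ᵏ⁾)` are nonsingular, with inverses bounded
uniformly over the iterations `k < N`. -/
def UniformlyNonsingular (X : Set E) (f : E → ℝ) (F : E → E) (T : Trace E) (N : ℕ∞) : Prop :=
  ∃ C : ℝ, ∀ k : ℕ, (k : ℕ∞) < N →
    (fderiv ℝ (H X f F (T.mu k)) (T.w k)).IsInvertible ∧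
      ‖(fderiv ℝ (H X f F (T.mu k)) (T.w k)).inverse‖ ≤ C

end Algorithm

/-- Second assumption: `‖F(y) - F(x) - DF(x)[y - x]‖ = o(‖y - x‖)`, uniformly over all `x, y`. -/
def HasUniformLittleO {E : Type*} [NormedAddCommGroup E] [NormedSpace ℝ E] (F : E → E) : Prop :=
  ∀ ε > 0, ∃ δ > 0, ∀ x y : E, ‖y - x‖ < δ →
    ‖F y - F x - fderiv ℝ F x (y - x)‖ ≤ ε * ‖y - x‖

/-- R-linear convergence of a sequence to `a`. -/
def RLinearTo {V : Type*} [NormedAddCommGroup V] (u : ℕ → V) (a : V) : Prop :=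
  ∃ M ρ : ℝ, 0 < ρ ∧ ρ < 1 ∧ ∀ k, ‖u k - a‖ ≤ M * ρ ^ k

/-- `γ̄ = min {1, β σ λ̄ / (β + √ϑ)}`. -/
def gammaBar (ϑ : ℝ) (P : Params) (lamBar : ℝ) : ℝ :=
  min 1 (P.β * P.σ * lamBar / (P.β + √ϑ))

end NICM

end

namespace NICM

/-! Two estimates for the smoothed projection `p_μ` carry the theorem, and both come from the
barrier. First, `p_μ` is `√ϑ`-Lipschitz in `μ`, down to `μ = 0`. The finite parameter makes `exp (-f
/ ϑ)` concave. This yields `one_le_mul_slopes`, and testing the equations for `p_μ` and `p_ν`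
against the difference of the two points gives the Lipschitz bound. Second, the Taylor remainder of
`p_μ` of order two is at most `‖h‖² / μ`. This follows by differentiating `u + μ² ∇f(u) = z` twice
along a line and using self-concordance (`norm_smoothProj_remainder_le`).

In the neighbourhood the merit is at most `β μ`, and so is, up to a factor, the length of the
centering direction. One factor of the quadratic remainder thus cancels the `1 / μ`, and the step
lengths accepted by the line search stay away from `0` uniformly in `μ` (`exists_uniform_decrease`).
A fixed fraction of merit is gained, and the Lipschitz bound in `μ` converts it into a fixed
fractional reduction of `μ` that keeps the iterate in the neighbourhood (`IsIteration.step`).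

Hence `μ` decays geometrically. Since `Ψ_0 ≤ (β + √ϑ) μ` at the iterates, so do the residuals. The
bounded inverses make the steps geometrically small, whichever candidate is taken. The approximate
Newton step needs no quality estimate, because it is adopted only if it lies in the neighbourhood.
-/

/-- A concave function on `[0, 1]` lies below its tangent at `0`. -/
lemma le_tangent_of_second_deriv_nonpos {g g' g'' : ℝ → ℝ}
    (h1 : ∀ t ∈ Set.Icc (0 : ℝ) 1, HasDerivAt g (g' t) t)
    (h2 : ∀ t ∈ Set.Icc (0 : ℝ) 1, HasDerivAt g' (g'' t) t)
    (h3 : ∀ t ∈ Set.Icc (0 : ℝ) 1, g'' t ≤ 0) : g 1 ≤ g 0 + g' 0 := by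
  have hanti : AntitoneOn g' (Set.Icc 0 1) := by
    refine antitoneOn_of_deriv_nonpos (convex_Icc 0 1)
      (fun t ht => (h2 t ht).continuousAt.continuousWithinAt)
      (fun t ht => ?_) (fun t ht => ?_)
    · exact (h2 t (interior_subset ht)).differentiableAt.differentiableWithinAt
    · rw [(h2 t (interior_subset ht)).deriv]
      exact h3 t (interior_subset ht)
  obtain ⟨c, hc, hc'⟩ := exists_hasDerivAt_eq_slope g g' zero_lt_one
    (fun t ht => (h1 t ht).continuousAt.continuousWithinAt)
    (fun t ht => h1 t (Set.Ioo_subset_Icc_self ht))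
  have := hanti (Set.left_mem_Icc.2 zero_le_one) (Set.Ioo_subset_Icc_self hc) hc.1.le
  rw [hc'] at this
  linarith

lemma _root_.HasDerivAt.clm_apply_const {V W : Type*} [NormedAddCommGroup V] [NormedSpace ℝ V]
    [NormedAddCommGroup W] [NormedSpace ℝ W] {c : ℝ → V →L[ℝ] W} {c' : V →L[ℝ] W} {t : ℝ}
    (h : HasDerivAt c c' t) (v : V) : HasDerivAt (fun s => c s v) (c' v) t :=
  (ContinuousLinearMap.apply ℝ W v).hasFDerivAt.comp_hasDerivAt t h

/-! ### Self-concordant barriers: convexity, third derivatives, slopes. -/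

section Barrier

variable {E : Type*} [NormedAddCommGroup E] [InnerProductSpace ℝ E]
  {ϑ : ℝ} {X : Set E} {f : E → ℝ}

namespace IsSelfConcordantBarrier

lemma contDiffAt (hf : IsSelfConcordantBarrier ϑ X f) {x : E} (hx : x ∈ interior X) :
    ContDiffAt ℝ 3 f x :=
  hf.contDiffOn.contDiffAt (isOpen_interior.mem_nhds hx)

lemma contDiffAt_fderiv (hf : IsSelfConcordantBarrier ϑ X f) {x : E} (hx : x ∈ interior X) :
    ContDiffAt ℝ 2 (fderiv ℝ f) x :=
  (hf.contDiffAt hx).fderiv_right (by norm_num)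

lemma contDiffAt_fderiv_fderiv (hf : IsSelfConcordantBarrier ϑ X f) {x : E}
    (hx : x ∈ interior X) : ContDiffAt ℝ 1 (fderiv ℝ (fderiv ℝ f)) x :=
  (hf.contDiffAt_fderiv hx).fderiv_right (by norm_num)

lemma hasFDerivAt (hf : IsSelfConcordantBarrier ϑ X f) {x : E} (hx : x ∈ interior X) :
    HasFDerivAt f (fderiv ℝ f x) x :=
  ((hf.contDiffAt hx).differentiableAt (by norm_num)).hasFDerivAt

lemma hasFDerivAt_fderiv (hf : IsSelfConcordantBarrier ϑ X f) {x : E} (hx : x ∈ interior X) :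
    HasFDerivAt (fderiv ℝ f) (fderiv ℝ (fderiv ℝ f) x) x :=
  ((hf.contDiffAt_fderiv hx).differentiableAt (by norm_num)).hasFDerivAt

lemma hasFDerivAt_fderiv_fderiv (hf : IsSelfConcordantBarrier ϑ X f) {x : E}
    (hx : x ∈ interior X) :
    HasFDerivAt (fderiv ℝ (fderiv ℝ f)) (fderiv ℝ (fderiv ℝ (fderiv ℝ f)) x) x :=
  ((hf.contDiffAt_fderiv_fderiv hx).differentiableAt (by norm_num)).hasFDerivAt

lemma hess_symm (hf : IsSelfConcordantBarrier ϑ X f) {x : E} (hx : x ∈ interior X) (a b : E) :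
    fderiv ℝ (fderiv ℝ f) x a b = fderiv ℝ (fderiv ℝ f) x b a :=
  (hf.contDiffAt hx).isSymmSndFDerivAt (by norm_num [minSmoothness]) a b

lemma third_symm_left (hf : IsSelfConcordantBarrier ϑ X f) {x : E} (hx : x ∈ interior X)
    (a b c : E) : fderiv ℝ (fderiv ℝ (fderiv ℝ f)) x a b c =
      fderiv ℝ (fderiv ℝ (fderiv ℝ f)) x b a c :=
  congrArg (fun l => l c) ((hf.contDiffAt_fderiv hx).isSymmSndFDerivAt (by simp) a b)

/-- The Hessian is symmetric at all nearby points, so its derivative in direction `a` is symmetric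
too. -/
lemma third_symm_right (hf : IsSelfConcordantBarrier ϑ X f) {x : E} (hx : x ∈ interior X)
    (a b c : E) : fderiv ℝ (fderiv ℝ (fderiv ℝ f)) x a b c =
      fderiv ℝ (fderiv ℝ (fderiv ℝ f)) x a c b := by
  have hl : HasDerivAt (fun s : ℝ => x + s • a) a 0 := by
    simpa using ((hasDerivAt_id (0 : ℝ)).smul_const a).const_add x
  have hl0 : x + (0 : ℝ) • a = x := by simp
  have h3 : HasDerivAt (fun s : ℝ => fderiv ℝ (fderiv ℝ f) (x + s • a))
      (fderiv ℝ (fderiv ℝ (fderiv ℝ f)) x a) 0 :=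
    HasFDerivAt.comp_hasDerivAt_of_eq (l := fderiv ℝ (fderiv ℝ f)) (0 : ℝ)
      (hf.hasFDerivAt_fderiv_fderiv hx) hl hl0.symm
  have key : ∀ b c : E, HasDerivAt (fun s : ℝ => fderiv ℝ (fderiv ℝ f) (x + s • a) b c)
      (fderiv ℝ (fderiv ℝ (fderiv ℝ f)) x a b c) 0 := fun b c =>
    (h3.clm_apply_const b).clm_apply_const c
  refine (key b c).unique ((key c b).congr_of_eventuallyEq ?_)
  have : ∀ᶠ s : ℝ in 𝓝 0, x + s • a ∈ interior X :=
    hl.continuousAt.eventually_mem (isOpen_interior.mem_nhds (by rwa [hl0]))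
  filter_upwards [this] with s hs using hf.hess_symm hs b c

lemma sq_fderiv_le_of_mem {t : ℝ} (ht : t ∈ {t : ℝ | 0 ≤ t ∧ ∀ x ∈ interior X, ∀ h : E,
      0 ≤ t * iteratedFDeriv ℝ 2 f x (fun _ => h) - (fderiv ℝ f x h) ^ 2}) {x : E}
    (hx : x ∈ interior X) (h : E) :
    (fderiv ℝ f x h) ^ 2 ≤ t * fderiv ℝ (fderiv ℝ f) x h h := by
  have := ht.2 x hx h
  rw [iteratedFDeriv_two_apply] at this
  linarith

lemma parameter_nonneg (hf : IsSelfConcordantBarrier ϑ X f) : 0 ≤ ϑ :=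
  hf.parameter.2 fun _ ht => ht.1

/-- Convexity of `f` is not part of the definition; it follows from the finiteness of the parameter.
For an admissible `t > 0` the Hessian form dominates a square. If `t = 0` is admissible, the
gradient vanishes on the interior. -/
lemma hess_nonneg (hf : IsSelfConcordantBarrier ϑ X f) {x : E} (hx : x ∈ interior X) (h : E) :
    0 ≤ fderiv ℝ (fderiv ℝ f) x h h := by
  obtain ⟨t, ht⟩ := hf.parameter.nonempty
  rcases ht.1.eq_or_lt with h0 | h0
  · have : fderiv ℝ f =ᶠ[𝓝 x] fun _ => 0 := by
      filter_upwards [isOpen_interior.mem_nhds hx] with y hy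
      ext v
      have := sq_fderiv_le_of_mem ht hy v
      rw [← h0, zero_mul] at this
      simpa using pow_eq_zero_iff (two_ne_zero) |>.1 (le_antisymm this (sq_nonneg _))
    rw [this.fderiv_eq]
    simp
  · exact nonneg_of_mul_nonneg_right ((sq_nonneg _).trans (sq_fderiv_le_of_mem ht hx h)) h0

/-- The infimum defining `ϑ` is attained, since each condition is a closed condition on `t`. -/
lemma sq_fderiv_le (hf : IsSelfConcordantBarrier ϑ X f) {x : E} (hx : x ∈ interior X) (h : E) :
    (fderiv ℝ f x h) ^ 2 ≤ ϑ * fderiv ℝ (fderiv ℝ f) x h h := by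
  rcases (hf.hess_nonneg hx h).eq_or_lt with h0 | h0
  · obtain ⟨t, ht⟩ := hf.parameter.nonempty
    have := sq_fderiv_le_of_mem ht hx h
    rw [← h0, mul_zero] at this ⊢
    exact this
  · rw [← div_le_iff₀ h0]
    exact hf.parameter.2 fun t ht => (div_le_iff₀ h0).2 (sq_fderiv_le_of_mem ht hx h)

lemma abs_third_le (hf : IsSelfConcordantBarrier ϑ X f) {x : E} (hx : x ∈ interior X) (h : E) :
    |fderiv ℝ (fderiv ℝ (fderiv ℝ f)) x h h h| ≤
      2 * (fderiv ℝ (fderiv ℝ f) x h h) ^ (3 / 2 : ℝ) := by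
  have := hf.concordant x hx h
  rw [iteratedFDeriv_two_apply, iteratedFDeriv_succ_apply_right] at this
  have h2 := iteratedFDeriv_two_apply (𝕜 := ℝ) (fun y => fderiv ℝ f y) x (fun _ => h)
  rw [← h2]
  exact this

/-- Polarization: `(a+b)³ - (a-b)³ - 2b³ = 6a²b`. By the parallelogram law `a ± b` have squared
local norm at most `4`, so the cubes contribute at most `16 + 16 + 4 = 36`. -/
lemma abs_third_mixed_le_of_le_one (hf : IsSelfConcordantBarrier ϑ X f) {x : E}
    (hx : x ∈ interior X) {a b : E} (ha : fderiv ℝ (fderiv ℝ f) x a a ≤ 1)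
    (hb : fderiv ℝ (fderiv ℝ f) x b b ≤ 1) :
    |fderiv ℝ (fderiv ℝ (fderiv ℝ f)) x a a b| ≤ 6 := by
  have bound : ∀ (v : E) (r : ℝ), 0 ≤ r → fderiv ℝ (fderiv ℝ f) x v v ≤ r ^ 2 →
      |fderiv ℝ (fderiv ℝ (fderiv ℝ f)) x v v v| ≤ 2 * r ^ 3 := fun v r hr hv => by
    refine (hf.abs_third_le hx v).trans ?_
    have := Real.rpow_le_rpow (hf.hess_nonneg hx v) hv (by norm_num : (0 : ℝ) ≤ 3 / 2)
    rw [← Real.rpow_natCast r 2, ← Real.rpow_mul hr] at this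
    norm_num at this
    linarith
  have hpar : fderiv ℝ (fderiv ℝ f) x (a + b) (a + b) +
      fderiv ℝ (fderiv ℝ f) x (a - b) (a - b) ≤ 4 := by
    simp only [map_add, map_sub, add_apply, sub_apply]
    linarith
  have h1 := bound (a + b) 2 (by norm_num) (by linarith [hf.hess_nonneg hx (a - b)])
  have h2 := bound (a - b) 2 (by norm_num) (by linarith [hf.hess_nonneg hx (a + b)])
  have h3 := bound b 1 (by norm_num) (by linarith)
  simp only [map_add, map_sub, add_apply, sub_apply] at h1 h2
  rw [hf.third_symm_left hx b a, hf.third_symm_right hx a b a, hf.third_symm_left hx b a,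
    hf.third_symm_right hx b b a, hf.third_symm_left hx b a] at h1 h2
  rw [abs_le] at *
  constructor <;> linarith

/-- The third derivative is bounded by the local norms also off the diagonal. -/
lemma abs_third_mixed_le (hf : IsSelfConcordantBarrier ϑ X f) {x : E} (hx : x ∈ interior X)
    (a b : E) : |fderiv ℝ (fderiv ℝ (fderiv ℝ f)) x a a b| ≤
      6 * fderiv ℝ (fderiv ℝ f) x a a * √(fderiv ℝ (fderiv ℝ f) x b b) := by
  -- The Hessian may be degenerate, so the vectors are normalized by local norm plus `e`, and `e →
  -- 0` at the end.
  have hscale : ∀ (v : E) (e : ℝ), 0 < e →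
      fderiv ℝ (fderiv ℝ f) x ((√(fderiv ℝ (fderiv ℝ f) x v v) + e)⁻¹ • v)
        ((√(fderiv ℝ (fderiv ℝ f) x v v) + e)⁻¹ • v) ≤ 1 := fun v e he => by
    have h0 := hf.hess_nonneg hx v
    set q := fderiv ℝ (fderiv ℝ f) x v v with hq
    simp only [map_smul, smul_apply, smul_eq_mul, ← hq]
    have hs := Real.sqrt_nonneg q
    rw [← mul_assoc, ← mul_inv, inv_mul_le_iff₀ (by positivity), mul_one]
    nlinarith [Real.sq_sqrt h0]
  have key : ∀ e : ℝ, 0 < e → |fderiv ℝ (fderiv ℝ (fderiv ℝ f)) x a a b| ≤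
      6 * (√(fderiv ℝ (fderiv ℝ f) x a a) + e) ^ 2 *
        (√(fderiv ℝ (fderiv ℝ f) x b b) + e) := fun e he => by
    have := hf.abs_third_mixed_le_of_le_one hx (hscale a e he) (hscale b e he)
    have h1 := Real.sqrt_nonneg (fderiv ℝ (fderiv ℝ f) x a a)
    have h2 := Real.sqrt_nonneg (fderiv ℝ (fderiv ℝ f) x b b)
    set α := √(fderiv ℝ (fderiv ℝ f) x a a) + e
    set γ := √(fderiv ℝ (fderiv ℝ f) x b b) + e
    have hα : 0 < α := by positivity
    have hγ : 0 < γ := by positivity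
    simp only [map_smul, smul_apply, smul_eq_mul] at this
    rw [← mul_assoc, ← mul_assoc, abs_mul, ← mul_inv, ← mul_inv, abs_inv,
      abs_of_pos (by positivity : 0 < γ * α * α), inv_mul_le_iff₀ (by positivity)] at this
    linarith
  have hlim : Tendsto (fun e : ℝ => 6 * (√(fderiv ℝ (fderiv ℝ f) x a a) + e) ^ 2 *
      (√(fderiv ℝ (fderiv ℝ f) x b b) + e)) (𝓝[>] 0)
      (𝓝 (6 * (√(fderiv ℝ (fderiv ℝ f) x a a) + 0) ^ 2 *
        (√(fderiv ℝ (fderiv ℝ f) x b b) + 0))) :=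
    (Continuous.tendsto (by fun_prop) 0).mono_left nhdsWithin_le_nhds
  have := ge_of_tendsto hlim (eventually_mem_nhdsWithin.mono key)
  rwa [add_zero, add_zero, Real.sq_sqrt (hf.hess_nonneg hx a)] at this

lemma hasDerivAt_segment (hf : IsSelfConcordantBarrier ϑ X f) {x d : E} {t : ℝ}
    (ht : x + t • d ∈ interior X) :
    HasDerivAt (fun s : ℝ => f (x + s • d)) (fderiv ℝ f (x + t • d) d) t ∧
    HasDerivAt (fun s : ℝ => fderiv ℝ f (x + s • d) d)
      (fderiv ℝ (fderiv ℝ f) (x + t • d) d d) t := by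
  have hl : HasDerivAt (fun s : ℝ => x + s • d) d t := by
    simpa using ((hasDerivAt_id t).smul_const d).const_add x
  have h2 : HasDerivAt (fun s : ℝ => fderiv ℝ f (x + s • d))
      (fderiv ℝ (fderiv ℝ f) (x + t • d) d) t := (hf.hasFDerivAt_fderiv ht).comp_hasDerivAt t hl
  exact ⟨(hf.hasFDerivAt ht).comp_hasDerivAt t hl, h2.clm_apply_const d⟩

lemma segment_mem_interior (hX : Convex ℝ X) {x y : E} (hx : x ∈ interior X)
    (hy : y ∈ interior X) {t : ℝ} (ht : t ∈ Set.Icc (0 : ℝ) 1) :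
    x + t • (y - x) ∈ interior X :=
  hX.interior.add_smul_sub_mem hx hy ht

/-- The gradient inequality of convex functions. -/
lemma add_fderiv_le (hf : IsSelfConcordantBarrier ϑ X f) (hX : Convex ℝ X) {x y : E}
    (hx : x ∈ interior X) (hy : y ∈ interior X) : f x + fderiv ℝ f x (y - x) ≤ f y := by
  have := le_tangent_of_second_deriv_nonpos
    (fun t ht => (hf.hasDerivAt_segment (segment_mem_interior hX hx hy ht)).1.neg)
    (fun t ht => (hf.hasDerivAt_segment (segment_mem_interior hX hx hy ht)).2.neg)
    (fun t ht => neg_nonpos.2 (hf.hess_nonneg (segment_mem_interior hX hx hy ht) _))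
  simp only [Pi.neg_apply, zero_smul, one_smul, add_zero, add_sub_cancel] at this
  linarith

lemma fderiv_monotone (hf : IsSelfConcordantBarrier ϑ X f) (hX : Convex ℝ X) {x y : E}
    (hx : x ∈ interior X) (hy : y ∈ interior X) :
    fderiv ℝ f x (y - x) ≤ fderiv ℝ f y (y - x) := by
  have h1 := hf.add_fderiv_le hX hx hy
  have h2 := hf.add_fderiv_le hX hy hx
  rw [← neg_sub, map_neg] at h2
  linarith

/-- `exp (-f / ϑ)` is concave: along a segment its second derivative has the sign of `(Df[d])² - ϑ
D²f[d,d]`. -/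
lemma exp_neg_le (hf : IsSelfConcordantBarrier ϑ X f) (hX : Convex ℝ X) (hϑ : 0 < ϑ) {x y : E}
    (hx : x ∈ interior X) (hy : y ∈ interior X) :
    Real.exp (-f y / ϑ) ≤ Real.exp (-f x / ϑ) * (1 - fderiv ℝ f x (y - x) / ϑ) := by
  have hmem := fun t ht => segment_mem_interior hX hx hy (t := t) ht
  have h1 := fun t ht => (hf.hasDerivAt_segment (hmem t ht)).1.neg.div_const ϑ |>.exp
  have h2 := fun t ht => (h1 t ht).mul
    ((hf.hasDerivAt_segment (hmem t ht)).2.neg.div_const ϑ)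
  have := le_tangent_of_second_deriv_nonpos h1 h2 (fun t ht => by
    have h3 := hf.sq_fderiv_le (hmem t ht) (y - x)
    simp only [Pi.neg_apply]
    set e := Real.exp (-f (x + t • (y - x)) / ϑ)
    set a := fderiv ℝ f (x + t • (y - x)) (y - x)
    set b := fderiv ℝ (fderiv ℝ f) (x + t • (y - x)) (y - x) (y - x)
    have : e * (-a / ϑ) * (-a / ϑ) + e * (-b / ϑ) = e * ((a ^ 2 - ϑ * b) / ϑ ^ 2) := by
      field_simp
      ring
    rw [this]
    exact mul_nonpos_of_nonneg_of_nonpos (Real.exp_nonneg _)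
      (div_nonpos_of_nonpos_of_nonneg (by linarith) (sq_nonneg _)))
  simp only [Pi.neg_apply, zero_smul, one_smul, add_zero, add_sub_cancel] at this
  refine this.trans (le_of_eq ?_)
  ring

/-- The relation between the slopes of a self-concordant barrier at two points. -/
lemma one_le_mul_slopes (hf : IsSelfConcordantBarrier ϑ X f) (hX : Convex ℝ X) (hϑ : 0 < ϑ)
    {x y : E} (hx : x ∈ interior X) (hy : y ∈ interior X) :
    fderiv ℝ f x (y - x) < ϑ ∧
    1 ≤ (1 - fderiv ℝ f x (y - x) / ϑ) * (1 + fderiv ℝ f y (y - x) / ϑ) := by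
  have h1 := hf.exp_neg_le hX hϑ hx hy
  have h2 := hf.exp_neg_le hX hϑ hy hx
  rw [← neg_sub y x, map_neg, neg_div _ (fderiv ℝ f y (y - x)), sub_neg_eq_add] at h2
  have e1 := Real.exp_pos (-f x / ϑ)
  have e2 := Real.exp_pos (-f y / ϑ)
  have ha : 0 < 1 - fderiv ℝ f x (y - x) / ϑ := pos_of_mul_pos_right (e2.trans_le h1) e1.le
  refine ⟨by rwa [sub_pos, div_lt_one hϑ] at ha, ?_⟩
  -- Chaining the tangent inequalities at `x` and at `y` makes the exponentials cancel.
  have h3 := h1.trans (mul_le_mul_of_nonneg_right h2 ha.le)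
  rw [mul_assoc] at h3
  have h4 := le_of_mul_le_mul_left ((mul_one _).le.trans h3) e2
  linarith

lemma fderiv_eq_zero_of_parameter (hf : IsSelfConcordantBarrier 0 X f) {x : E}
    (hx : x ∈ interior X) (h : E) : fderiv ℝ f x h = 0 := by
  have := hf.sq_fderiv_le hx h
  rw [zero_mul] at this
  exact pow_eq_zero_iff (two_ne_zero) |>.1 (le_antisymm this (sq_nonneg _))

/-- For `y` in the interior this is a slope bound; a convex set with nonempty interior lies in the
closure of that interior. -/
lemma fderiv_sub_le_parameter (hf : IsSelfConcordantBarrier ϑ X f) (hX : Convex ℝ X) {x y : E}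
    (hx : x ∈ interior X) (hy : y ∈ X) : fderiv ℝ f x (y - x) ≤ ϑ := by
  have hcl : X ⊆ closure (interior X) := by
    rw [hX.closure_interior_eq_closure_of_nonempty_interior ⟨x, hx⟩]
    exact subset_closure
  refine closure_minimal (t := {y | fderiv ℝ f x (y - x) ≤ ϑ}) (fun y hy => ?_)
    (isClosed_le (by fun_prop) continuous_const) (hcl hy)
  rcases hf.parameter_nonneg.eq_or_lt with h0 | h0
  · subst h0
    exact (hf.fderiv_eq_zero_of_parameter hx _).le
  · exact (hf.one_le_mul_slopes hX h0 hx hy).1.le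

/-- This is the estimate behind the Lipschitz dependence of `p_μ` on `μ`. In terms of the two
factors `r`, `s` of `one_le_mul_slopes`, the left side is `ϑ (μ² + ν² - μ² r - ν² s)`. -/
lemma slopes_le (hf : IsSelfConcordantBarrier ϑ X f) (hX : Convex ℝ X) {x y : E}
    (hx : x ∈ interior X) (hy : y ∈ interior X) (μ ν : ℝ) :
    μ ^ 2 * fderiv ℝ f x (y - x) - ν ^ 2 * fderiv ℝ f y (y - x) ≤ ϑ * (μ - ν) ^ 2 := by
  rcases hf.parameter_nonneg.eq_or_lt with h0 | h0
  · subst h0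
    simp [hf.fderiv_eq_zero_of_parameter hx, hf.fderiv_eq_zero_of_parameter hy]
  obtain ⟨h1, h2⟩ := hf.one_le_mul_slopes hX h0 hx hy
  have ha : fderiv ℝ f x (y - x) = ϑ * (1 - (1 - fderiv ℝ f x (y - x) / ϑ)) := by
    field_simp
    ring
  have hb : fderiv ℝ f y (y - x) = ϑ * ((1 + fderiv ℝ f y (y - x) / ϑ) - 1) := by
    field_simp
    ring
  have hr : 0 < 1 - fderiv ℝ f x (y - x) / ϑ := by rwa [sub_pos, div_lt_one h0]
  set r := 1 - fderiv ℝ f x (y - x) / ϑ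
  set s := 1 + fderiv ℝ f y (y - x) / ϑ
  rw [ha, hb]
  have hs : 0 < s := pos_of_mul_pos_right (zero_lt_one.trans_le h2) hr.le
  -- The arithmetic-geometric mean inequality, combined with `1 ≤ r * s`.
  have key : 2 * (μ * ν) ≤ μ ^ 2 * r + ν ^ 2 * s := by
    refine abs_le_of_sq_le_sq' ?_ (by positivity) |>.2
    nlinarith [sq_nonneg (μ ^ 2 * r - ν ^ 2 * s), mul_nonneg (sq_nonneg (μ * ν)) (sub_nonneg.2 h2)]
  nlinarith

end IsSelfConcordantBarrier

end Barrier

/-! ### The smoothed projection: existence, Lipschitz bounds, smoothness, remainder. -/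

section Smoothing

lemma norm_le_of_sq_le {E : Type*} [NormedAddCommGroup E] [InnerProductSpace ℝ E] {a : E} {r : ℝ}
    (hr : 0 ≤ r) (h : inner ℝ a a ≤ r ^ 2) : ‖a‖ ≤ r := by
  rw [real_inner_self_eq_norm_sq] at h
  exact abs_le_of_sq_le_sq' h hr |>.2

variable {E : Type*} [NormedAddCommGroup E] [InnerProductSpace ℝ E] [FiniteDimensional ℝ E]
  {ϑ : ℝ} {X : Set E} {f : E → ℝ}

lemma proj_spec (hc : IsClosed X) (hX : Convex ℝ X) (hne : X.Nonempty) (z : E) :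
    proj X z ∈ X ∧ ∀ v ∈ X, inner ℝ (z - proj X z) (v - proj X z) ≤ 0 := by
  have hex : ∃ x, x ∈ X ∧ ∀ v ∈ X, ‖x - z‖ ≤ ‖v - z‖ := by
    obtain ⟨x, hx, hxz⟩ := hc.exists_infDist_eq_dist hne z
    refine ⟨x, hx, fun v hv => ?_⟩
    rw [← dist_eq_norm, ← dist_eq_norm, dist_comm x, dist_comm v, ← hxz]
    exact Metric.infDist_le_dist_of_mem hv
  have hp := Classical.epsilon_spec hex
  change proj X z ∈ X ∧ ∀ v ∈ X, ‖proj X z - z‖ ≤ ‖v - z‖ at hp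
  refine ⟨hp.1, (norm_eq_iInf_iff_real_inner_le_zero hX hp.1).1 ?_⟩
  have : Nonempty X := hne.to_subtype
  refine le_antisymm (le_ciInf fun w => ?_) (ciInf_le ⟨0, ?_⟩ (⟨_, hp.1⟩ : X))
  · rw [norm_sub_rev, norm_sub_rev z]
    exact hp.2 w w.2
  · rintro _ ⟨w, rfl⟩
    exact norm_nonneg _

lemma inner_gradient (f : E → ℝ) (u v : E) : inner ℝ (gradient f u) v = fderiv ℝ f u v := by
  simp [gradient, InnerProductSpace.toDual_symm_apply]

/-- The equation is the stationarity condition of `½‖u - z‖² + μ² f(u)`. A minimizer exists because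
the barrier property keeps the sublevel set `K` closed and an affine minorant of `f` keeps it
bounded. -/
lemma exists_add_smul_gradient_eq (hf : IsSelfConcordantBarrier ϑ X f) (hc : IsClosed X)
    (hX : Convex ℝ X) (hne : (interior X).Nonempty) {μ : ℝ} (hμ : 0 < μ) (z : E) :
    ∃ u, u ∈ interior X ∧ u + μ ^ 2 • gradient f u = z := by
  obtain ⟨x₀, hx₀⟩ := hne
  set g : E → ℝ := fun u => 1 / 2 * ‖u - z‖ ^ 2 + μ ^ 2 * f u with hg
  have hgc : ∀ u ∈ interior X, ContinuousAt g u := fun u hu => by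
    have := (hf.hasFDerivAt hu).continuousAt
    fun_prop
  set K := {u | u ∈ interior X ∧ g u ≤ g x₀} with hK
  have hKcl : IsClosed K := by
    refine IsSeqClosed.isClosed fun u x hu hux => ?_
    have hxX : x ∈ X := hc.mem_of_tendsto hux (Eventually.of_forall fun n =>
      interior_subset (hu n).1)
    by_cases hx : x ∈ interior X
    · exact ⟨hx, le_of_tendsto ((hgc x hx).tendsto.comp hux)
        (Eventually.of_forall fun n => (hu n).2)⟩
    · exfalso
      have h1 := hf.barrier u (fun n => (hu n).1) x (by rw [hc.frontier_eq]; exact ⟨hxX, hx⟩) hux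
      obtain ⟨n, hn⟩ := (h1.eventually_gt_atTop (g x₀ / μ ^ 2)).exists
      rw [div_lt_iff₀' (by positivity)] at hn
      have h2 := (hu n).2
      simp only [hg] at h2 hn
      nlinarith [sq_nonneg ‖u n - z‖]
  have hKb : Bornology.IsBounded K := by
    set a := fderiv ℝ f x₀
    refine (Metric.isBounded_iff_subset_closedBall x₀).2
      -- From `g u ≤ g x₀` and the gradient inequality, `½‖u - x₀‖² ≤ ‖u - x₀‖ (‖x₀ - z‖ + μ²‖a‖)`.
      ⟨2 * (‖x₀ - z‖ + μ ^ 2 * ‖a‖), fun u hu => ?_⟩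
    rw [mem_closedBall_iff_norm]
    have h1 := hf.add_fderiv_le hX hx₀ hu.1
    have h2 := hu.2
    simp only [hg] at h2
    have h3 := (abs_le.1 (a.le_opNorm (u - x₀))).1
    have h4 : ‖u - z‖ ^ 2 = ‖u - x₀‖ ^ 2 + 2 * inner ℝ (u - x₀) (x₀ - z) + ‖x₀ - z‖ ^ 2 := by
      rw [← norm_add_sq_real, sub_add_sub_cancel]
    have h5 := (abs_le.1 (abs_real_inner_le_norm (u - x₀) (x₀ - z))).1
    have h6 : μ ^ 2 * (-(‖a‖ * ‖u - x₀‖)) ≤ μ ^ 2 * (f u - f x₀) :=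
      mul_le_mul_of_nonneg_left (by linarith) (sq_nonneg μ)
    by_contra! hlt
    have : 0 < ‖u - x₀‖ := lt_of_le_of_lt (by positivity) hlt
    nlinarith
  obtain ⟨u, hu, hmin⟩ := (Metric.isCompact_of_isClosed_isBounded hKcl hKb).exists_isMinOn
    ⟨x₀, hx₀, le_rfl⟩ (fun u hu => (hgc u hu.1).continuousWithinAt)
  refine ⟨u, hu.1, ?_⟩
  have hloc : IsLocalMin g u := by
    filter_upwards [isOpen_interior.mem_nhds hu.1] with v hv
    by_cases hvK : g v ≤ g x₀
    · exact hmin ⟨hv, hvK⟩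
    · exact hu.2.trans (not_le.1 hvK).le
  have hd : HasFDerivAt g ((1 / 2 : ℝ) • (2 • (innerSL ℝ (u - z)).comp
      (ContinuousLinearMap.id ℝ E)) + μ ^ 2 • fderiv ℝ f u) u :=
    ((((hasFDerivAt_id u).sub_const z).norm_sq).const_mul (1 / 2)).add
      ((hf.hasFDerivAt hu.1).const_mul (μ ^ 2))
  have h0 := hloc.hasFDerivAt_eq_zero hd
  refine ext_inner_right ℝ fun v => ?_
  have := congrArg (fun l => l v) h0
  simp at this
  rw [inner_add_left, real_inner_smul_left, inner_gradient]
  linarith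

lemma smoothProj_spec (hf : IsSelfConcordantBarrier ϑ X f) (hc : IsClosed X)
    (hX : Convex ℝ X) (hne : (interior X).Nonempty) {μ : ℝ} (hμ : 0 < μ) (z : E) :
    smoothProj X f μ z ∈ interior X ∧
      smoothProj X f μ z + μ ^ 2 • gradient f (smoothProj X f μ z) = z := by
  rw [smoothProj, if_pos hμ]
  exact Classical.epsilon_spec (exists_add_smul_gradient_eq hf hc hX hne hμ z)

lemma inner_smoothProj (hf : IsSelfConcordantBarrier ϑ X f) (hc : IsClosed X)
    (hX : Convex ℝ X) (hne : (interior X).Nonempty) {μ : ℝ} (hμ : 0 < μ) (z v : E) :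
    inner ℝ (smoothProj X f μ z) v + μ ^ 2 * fderiv ℝ f (smoothProj X f μ z) v =
      inner ℝ z v := by
  have := (smoothProj_spec hf hc hX hne hμ z).2
  nth_rw 3 [← this]
  rw [inner_add_left, real_inner_smul_left, inner_gradient]

lemma smoothProj_zero (X : Set E) (f : E → ℝ) (z : E) : smoothProj X f 0 z = proj X z :=
  if_neg (lt_irrefl _)

/-- Testing the equation for `u = p_μ(z)` with `u - q`, the projection inequality leaves `‖u - q‖² ≤
μ² Df(u)[q - u] ≤ μ² ϑ`. -/
lemma norm_smoothProj_sub_proj_le (hf : IsSelfConcordantBarrier ϑ X f) (hc : IsClosed X)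
    (hX : Convex ℝ X) (hne : (interior X).Nonempty) {μ : ℝ} (hμ : 0 < μ) (z : E) :
    ‖smoothProj X f μ z - proj X z‖ ≤ √ϑ * μ := by
  obtain ⟨hq, hq'⟩ := proj_spec hc hX (hne.mono interior_subset) z
  have hu := (smoothProj_spec hf hc hX hne hμ z).1
  have h1 := inner_smoothProj hf hc hX hne hμ z (smoothProj X f μ z - proj X z)
  set u := smoothProj X f μ z
  set q := proj X z
  have h2 := hq' u (interior_subset hu)
  have h3 := hf.fderiv_sub_le_parameter hX hu hq
  rw [← neg_sub u q, map_neg] at h3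
  refine norm_le_of_sq_le (by positivity) ?_
  rw [mul_pow, Real.sq_sqrt hf.parameter_nonneg]
  rw [inner_sub_left] at h2 ⊢
  nlinarith [mul_le_mul_of_nonneg_left h3 (sq_nonneg μ)]

/-- The smoothed projection is Lipschitz in the smoothing parameter. -/
lemma norm_smoothProj_sub_smoothProj_le (hf : IsSelfConcordantBarrier ϑ X f) (hc : IsClosed X)
    (hX : Convex ℝ X) (hne : (interior X).Nonempty) {μ ν : ℝ} (hμ : 0 ≤ μ) (hν : 0 ≤ ν) (z : E) :
    ‖smoothProj X f μ z - smoothProj X f ν z‖ ≤ √ϑ * |μ - ν| := by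
  rcases hμ.eq_or_lt with rfl | hμ' <;> rcases hν.eq_or_lt with rfl | hν'
  · simp
  · rw [norm_sub_rev, smoothProj_zero, zero_sub, abs_neg, abs_of_pos hν']
    exact norm_smoothProj_sub_proj_le hf hc hX hne hν' z
  · rw [smoothProj_zero, sub_zero, abs_of_pos hμ']
    exact norm_smoothProj_sub_proj_le hf hc hX hne hμ' z
  · have hu := (smoothProj_spec hf hc hX hne hμ' z).1
    have hv := (smoothProj_spec hf hc hX hne hν' z).1
    have h1 := inner_smoothProj hf hc hX hne hμ' z (smoothProj X f μ z - smoothProj X f ν z)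
    have h2 := inner_smoothProj hf hc hX hne hν' z (smoothProj X f μ z - smoothProj X f ν z)
    have h3 := hf.slopes_le hX hv hu ν μ
    refine norm_le_of_sq_le (by positivity) ?_
    rw [mul_pow, Real.sq_sqrt hf.parameter_nonneg, sq_abs, inner_sub_left]
    linarith [sq_abs (μ - ν), sub_sq_comm μ ν]

/-- Monotonicity of `∇f` (of the normal cone when `μ = 0`) gives firm nonexpansiveness, and
Cauchy-Schwarz does the rest. -/
lemma norm_smoothProj_sub_le (hf : IsSelfConcordantBarrier ϑ X f) (hc : IsClosed X)
    (hX : Convex ℝ X) (hne : (interior X).Nonempty) {μ : ℝ} (hμ : 0 ≤ μ) (z z' : E) :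
    ‖smoothProj X f μ z - smoothProj X f μ z'‖ ≤ ‖z - z'‖ := by
  suffices h : inner ℝ (smoothProj X f μ z - smoothProj X f μ z')
      (smoothProj X f μ z - smoothProj X f μ z') ≤
      inner ℝ (z - z') (smoothProj X f μ z - smoothProj X f μ z') by
    have h1 := h.trans (real_inner_le_norm _ _)
    rw [real_inner_self_eq_norm_sq, sq] at h1
    rcases (norm_nonneg (smoothProj X f μ z - smoothProj X f μ z')).eq_or_lt with h0 | h0
    · rw [← h0]
      positivity
    · exact le_of_mul_le_mul_right h1 h0
  rcases hμ.eq_or_lt with rfl | hμ'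
  · simp only [smoothProj_zero]
    obtain ⟨h1, h2⟩ := proj_spec hc hX (hne.mono interior_subset) z
    obtain ⟨h3, h4⟩ := proj_spec hc hX (hne.mono interior_subset) z'
    have h5 := h2 _ h3
    have h6 := h4 _ h1
    rw [← neg_sub (proj X z) (proj X z'), inner_neg_right] at h5
    rw [inner_sub_left] at h5 h6
    rw [inner_sub_left, inner_sub_left z]
    linarith
  · have h1 := inner_smoothProj hf hc hX hne hμ' z (smoothProj X f μ z - smoothProj X f μ z')
    have h2 := inner_smoothProj hf hc hX hne hμ' z' (smoothProj X f μ z - smoothProj X f μ z')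
    have h3 := hf.fderiv_monotone hX (smoothProj_spec hf hc hX hne hμ' z').1
      (smoothProj_spec hf hc hX hne hμ' z).1
    rw [inner_sub_left, inner_sub_left z, ← h1, ← h2]
    nlinarith [sq_nonneg μ]

lemma continuous_smoothProj (hf : IsSelfConcordantBarrier ϑ X f) (hc : IsClosed X)
    (hX : Convex ℝ X) (hne : (interior X).Nonempty) {μ : ℝ} (hμ : 0 ≤ μ) :
    Continuous (smoothProj X f μ) :=
  (LipschitzWith.of_dist_le_mul (K := 1) fun z z' => by
    simpa [dist_eq_norm] using norm_smoothProj_sub_le hf hc hX hne hμ z z').continuous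

/-- Uniqueness of the solution, again from monotonicity of `∇f`. -/
lemma smoothProj_add_smul_gradient (hf : IsSelfConcordantBarrier ϑ X f) (hc : IsClosed X)
    (hX : Convex ℝ X) (hne : (interior X).Nonempty) {μ : ℝ} (hμ : 0 < μ) {u : E}
    (hu : u ∈ interior X) : smoothProj X f μ (u + μ ^ 2 • gradient f u) = u := by
  set z := u + μ ^ 2 • gradient f u with hz
  have hv := (smoothProj_spec hf hc hX hne hμ z).1
  have h1 := inner_smoothProj hf hc hX hne hμ z (smoothProj X f μ z - u)
  have h3 := hf.fderiv_monotone hX hu hv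
  nth_rw 4 [hz] at h1
  rw [inner_add_left, real_inner_smul_left, inner_gradient] at h1
  rw [← sub_eq_zero, ← norm_le_zero_iff]
  refine norm_le_of_sq_le le_rfl ?_
  rw [inner_sub_left]
  nlinarith [mul_le_mul_of_nonneg_left h3 (sq_nonneg μ)]

/-- The Riesz isomorphism of a real space, as a linear equivalence. -/
noncomputable def riesz (E : Type*) [NormedAddCommGroup E] [InnerProductSpace ℝ E]
    [FiniteDimensional ℝ E] : (E →L[ℝ] ℝ) ≃L[ℝ] E :=
  LinearEquiv.toContinuousLinearEquiv
    { toFun := (InnerProductSpace.toDual ℝ E).symm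
      invFun := InnerProductSpace.toDual ℝ E
      map_add' := fun a b => map_add _ a b
      map_smul' := fun r a => by simp
      left_inv := fun a => by simp
      right_inv := fun a => by simp }

lemma riesz_apply (l : E →L[ℝ] ℝ) : riesz E l = (InnerProductSpace.toDual ℝ E).symm l := rfl

lemma inner_riesz (l : E →L[ℝ] ℝ) (v : E) : inner ℝ (riesz E l) v = l v := by
  simp [riesz_apply, InnerProductSpace.toDual_symm_apply]

/-- `p_μ` is the global inverse of `u ↦ u + μ² ∇f(u)`, whose derivative is the identity plus a
positive semidefinite map, hence invertible. -/
lemma contDiff_smoothProj (hf : IsSelfConcordantBarrier ϑ X f) (hc : IsClosed X)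
    (hX : Convex ℝ X) (hne : (interior X).Nonempty) {μ : ℝ} (hμ : 0 < μ) :
    ContDiff ℝ 2 (smoothProj X f μ) := by
  have hS : ∀ u ∈ interior X, ContDiffAt ℝ 2 (fun u => u + μ ^ 2 • gradient f u) u :=
    fun u hu => contDiffAt_id.add
      (((riesz E).contDiff.contDiffAt.comp u (hf.contDiffAt_fderiv hu)).const_smul (μ ^ 2))
  let S : OpenPartialHomeomorph E E :=
    { toFun := fun u => u + μ ^ 2 • gradient f u
      invFun := smoothProj X f μ
      source := interior X
      target := Set.univ
      map_source' := fun _ _ => Set.mem_univ _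
      map_target' := fun z _ => (smoothProj_spec hf hc hX hne hμ z).1
      left_inv' := fun u hu => smoothProj_add_smul_gradient hf hc hX hne hμ hu
      right_inv' := fun z _ => (smoothProj_spec hf hc hX hne hμ z).2
      open_source := isOpen_interior
      open_target := isOpen_univ
      continuousOn_toFun := fun u hu => (hS u hu).continuousAt.continuousWithinAt
      continuousOn_invFun := (continuous_smoothProj hf hc hX hne hμ.le).continuousOn }
  refine contDiff_iff_contDiffAt.2 fun z => ?_
  have hu := (smoothProj_spec hf hc hX hne hμ z).1
  set u := smoothProj X f μ z
  set D : E →L[ℝ] E := ContinuousLinearMap.id ℝ E +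
    μ ^ 2 • ((riesz E : (E →L[ℝ] ℝ) →L[ℝ] E).comp (fderiv ℝ (fderiv ℝ f) u)) with hD
  have hder : HasFDerivAt (fun u => u + μ ^ 2 • gradient f u) D u :=
    (hasFDerivAt_id u).add
      (((riesz E).hasFDerivAt.comp u (hf.hasFDerivAt_fderiv hu)).const_smul (μ ^ 2))
  have hinj : Function.Injective D := by
    refine (injective_iff_map_eq_zero D).2 fun v hv => ?_
    have h1 : inner ℝ (D v) v = 0 := by rw [hv, inner_zero_left]
    simp only [hD, add_apply, smul_apply, ContinuousLinearMap.id_apply,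
      ContinuousLinearMap.comp_apply, ContinuousLinearEquiv.coe_coe] at h1
    rw [inner_add_left, real_inner_smul_left, inner_riesz] at h1
    rw [← norm_le_zero_iff]
    refine norm_le_of_sq_le le_rfl ?_
    nlinarith [mul_nonneg (sq_nonneg μ) (hf.hess_nonneg hu v)]
  exact S.contDiffAt_symm (f₀' := (LinearEquiv.ofInjectiveEndo (D : E →ₗ[ℝ] E)
    hinj).toContinuousLinearEquiv) (Set.mem_univ z) hder (hS u hu)

/-- The second-order remainder of the smoothed projection. -/
lemma norm_smoothProj_remainder_le (hf : IsSelfConcordantBarrier ϑ X f) (hc : IsClosed X)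
    (hX : Convex ℝ X) (hne : (interior X).Nonempty) {μ : ℝ} (hμ : 0 < μ) (z h : E) :
    ‖smoothProj X f μ (z + h) - smoothProj X f μ z - fderiv ℝ (smoothProj X f μ) z h‖ ≤
      ‖h‖ ^ 2 / μ := by
  have hC := contDiff_smoothProj hf hc hX hne hμ
  have hl : ∀ t : ℝ, HasDerivAt (fun s : ℝ => z + s • h) h t := fun t => by
    simpa using ((hasDerivAt_id t).smul_const h).const_add z
  set u : ℝ → E := fun t => smoothProj X f μ (z + t • h) with hu
  set u₁ : ℝ → E := fun t => fderiv ℝ (smoothProj X f μ) (z + t • h) h with hu₁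
  set u₂ : ℝ → E := fun t => fderiv ℝ (fderiv ℝ (smoothProj X f μ)) (z + t • h) h h with hu₂
  have hmem : ∀ t, u t ∈ interior X := fun t => (smoothProj_spec hf hc hX hne hμ _).1
  have d1 : ∀ t, HasDerivAt u (u₁ t) t := fun t =>
    ((hC.differentiable (by norm_num)) _).hasFDerivAt.comp_hasDerivAt t (hl t)
  have d2 : ∀ t, HasDerivAt u₁ (u₂ t) t := fun t => by
    have h1 : ContDiff ℝ 1 (fderiv ℝ (smoothProj X f μ)) := hC.fderiv_right (by norm_num)
    have h2 : HasDerivAt (fun t : ℝ => fderiv ℝ (smoothProj X f μ) (z + t • h))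
        (fderiv ℝ (fderiv ℝ (smoothProj X f μ)) (z + t • h) h) t :=
      HasFDerivAt.comp_hasDerivAt (l := fderiv ℝ (smoothProj X f μ)) t
        ((h1.differentiable (by norm_num)) _).hasFDerivAt (hl t)
    exact h2.clm_apply_const h
  have dinner : ∀ (c : ℝ → E) (c' v : E) (t : ℝ), HasDerivAt c c' t →
      HasDerivAt (fun s => inner ℝ (c s) v) (inner ℝ c' v) t := fun c c' v t hcd => by
    simpa using hcd.inner ℝ (hasDerivAt_const t v)
  -- `e1` and `e2` are the first and second derivatives in `t` of the defining equation, in weak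
  -- form.
  have e1 : ∀ t v, inner ℝ (u₁ t) v + μ ^ 2 * fderiv ℝ (fderiv ℝ f) (u t) (u₁ t) v =
      inner ℝ h v := fun t v => by
    have hA : HasDerivAt (fun s => fderiv ℝ f (u s)) (fderiv ℝ (fderiv ℝ f) (u t) (u₁ t)) t :=
      HasFDerivAt.comp_hasDerivAt (l := fderiv ℝ f) t (hf.hasFDerivAt_fderiv (hmem t)) (d1 t)
    have hL := (dinner u _ v t (d1 t)).add ((hA.clm_apply_const v).const_mul (μ ^ 2))
    refine hL.unique ((dinner _ _ v t (hl t)).congr_of_eventuallyEq (Eventually.of_forall ?_))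
    exact fun s => inner_smoothProj hf hc hX hne hμ (z + s • h) v
  have e2 : ∀ t v, inner ℝ (u₂ t) v +
      μ ^ 2 * (fderiv ℝ (fderiv ℝ (fderiv ℝ f)) (u t) (u₁ t) (u₁ t) v +
        fderiv ℝ (fderiv ℝ f) (u t) (u₂ t) v) = 0 := fun t v => by
    have hB : HasDerivAt (fun s => fderiv ℝ (fderiv ℝ f) (u s))
        (fderiv ℝ (fderiv ℝ (fderiv ℝ f)) (u t) (u₁ t)) t :=
      HasFDerivAt.comp_hasDerivAt (l := fderiv ℝ (fderiv ℝ f)) t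
        (hf.hasFDerivAt_fderiv_fderiv (hmem t)) (d1 t)
    have hL := (dinner u₁ _ v t (d2 t)).add
      (((hB.clm_apply (d2 t)).clm_apply_const v).const_mul (μ ^ 2))
    exact hL.unique ((hasDerivAt_const t (inner ℝ h v)).congr_of_eventuallyEq
      (Eventually.of_forall fun s => e1 s v))
  have bound : ∀ t, ‖u₂ t‖ ≤ ‖h‖ ^ 2 / μ := fun t => by
    have q1 := hf.hess_nonneg (hmem t) (u₁ t)
    have q2 := hf.hess_nonneg (hmem t) (u₂ t)
    have a1 := e1 t (u₁ t)
    have a2 := e2 t (u₂ t)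
    have a3 := (abs_le.1 (hf.abs_third_mixed_le (hmem t) (u₁ t) (u₂ t))).1
    have a4 := real_inner_le_norm h (u₁ t)
    have hs := Real.sqrt_nonneg (fderiv ℝ (fderiv ℝ f) (u t) (u₂ t) (u₂ t))
    have hs2 := Real.sq_sqrt q2
    set s := √(fderiv ℝ (fderiv ℝ f) (u t) (u₂ t) (u₂ t))
    rw [real_inner_self_eq_norm_sq] at a1
    -- Testing `e1` with `u₁` gives `μ² D²f[u₁,u₁] ≤ ‖h‖‖u₁‖ - ‖u₁‖²`.
    have b1 : μ ^ 2 * fderiv ℝ (fderiv ℝ f) (u t) (u₁ t) (u₁ t) ≤ ‖h‖ ^ 2 / 4 := by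
      nlinarith [sq_nonneg (‖u₁ t‖ - ‖h‖ / 2)]
    have b2 := mul_le_mul_of_nonneg_right b1 hs
    refine norm_le_of_sq_le (by positivity) ?_
    rw [div_pow, le_div_iff₀ (by positivity)]
    -- Testing `e2` with `u₂`; the maximum of the right side over `s` is `(9/16)‖h‖⁴ / μ²`.
    have b3 : inner ℝ (u₂ t) (u₂ t) ≤ 3 / 2 * ‖h‖ ^ 2 * s - μ ^ 2 * s ^ 2 := by
      rw [hs2]
      nlinarith [mul_le_mul_of_nonneg_left a3 (sq_nonneg μ)]
    nlinarith [mul_le_mul_of_nonneg_right b3 (sq_nonneg μ), sq_nonneg (μ ^ 2 * s - 3 / 4 * ‖h‖ ^ 2),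
      sq_nonneg (‖h‖ ^ 2)]
  have hK : 0 ≤ ‖h‖ ^ 2 / μ := by positivity
  have step1 : ∀ t ∈ Set.Icc (0 : ℝ) 1, ‖u₁ t - u₁ 0‖ ≤ ‖h‖ ^ 2 / μ := fun t ht =>
    (norm_image_sub_le_of_norm_deriv_le_segment' (fun x _ => (d2 x).hasDerivWithinAt)
      (fun x _ => bound x) t ht).trans (mul_le_of_le_one_right hK (by linarith [ht.2]))
  have step2 := norm_image_sub_le_of_norm_deriv_le_segment_01' (f := fun t => u t - t • u₁ 0)
    (f' := fun t => u₁ t - u₁ 0) (C := ‖h‖ ^ 2 / μ)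
    (fun x _ => by
      have := ((d1 x).sub ((hasDerivAt_id x).smul_const (u₁ 0))).hasDerivWithinAt
        (s := Set.Icc 0 1)
      rw [one_smul] at this
      exact this)
    (fun x hx => step1 x (Set.Ico_subset_Icc_self hx))
  simp only [hu, hu₁, one_smul, zero_smul, add_zero, sub_zero] at step2
  rwa [sub_right_comm] at step2

end Smoothing

/-! ### The merit function and its decrease along inexact Newton directions. -/

section Merit

variable {E : Type*} [NormedAddCommGroup E]

lemma norm_fst_add_norm_snd_le (v : Pair E) : ‖v.fst‖ + ‖v.snd‖ ≤ √2 * ‖v‖ := by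
  refine abs_le_of_sq_le_sq' ?_ (by positivity) |>.2
  rw [mul_pow, Real.sq_sqrt zero_le_two, WithLp.prod_norm_sq_eq_of_L2]
  nlinarith [sq_nonneg (‖v.fst‖ - ‖v.snd‖)]

lemma norm_le_norm_fst_add_norm_snd (v : Pair E) : ‖v‖ ≤ ‖v.fst‖ + ‖v.snd‖ := by
  refine abs_le_of_sq_le_sq' ?_ (by positivity) |>.2
  rw [WithLp.prod_norm_sq_eq_of_L2]
  nlinarith [mul_nonneg (norm_nonneg v.fst) (norm_nonneg v.snd)]

lemma norm_fst_le (v : Pair E) : ‖v.fst‖ ≤ ‖v‖ := by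
  refine abs_le_of_sq_le_sq' ?_ (by positivity) |>.2
  rw [WithLp.prod_norm_sq_eq_of_L2]
  nlinarith [sq_nonneg ‖v.snd‖]

variable [InnerProductSpace ℝ E]

lemma norm_fst_sub_snd_sq_le (v : Pair E) : ‖v.fst - v.snd‖ ^ 2 ≤ 2 * ‖v‖ ^ 2 := by
  rw [WithLp.prod_norm_sq_eq_of_L2]
  nlinarith [parallelogram_law_with_norm ℝ v.fst v.snd, sq_nonneg ‖v.fst + v.snd‖]

variable [FiniteDimensional ℝ E] {ϑ : ℝ} {X : Set E} {f : E → ℝ} {F : E → E}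

lemma merit_nonneg (X : Set E) (f : E → ℝ) (F : E → E) (μ : ℝ) (w : Pair E) :
    0 ≤ merit X f F μ w := by
  unfold merit
  positivity

lemma norm_H_le_merit (X : Set E) (f : E → ℝ) (F : E → E) (μ : ℝ) (w : Pair E) :
    ‖H X f F μ w‖ ≤ merit X f F μ w :=
  (norm_le_norm_fst_add_norm_snd _).trans (add_comm _ _).le

lemma H_eq_zero_of_merit_nonpos {μ : ℝ} {w : Pair E} (h : merit X f F μ w ≤ 0) :
    H X f F μ w = 0 :=
  norm_le_zero_iff.1 ((norm_H_le_merit X f F μ w).trans h)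

lemma merit_pos_of_H_ne_zero {μ : ℝ} {w : Pair E} (h : H X f F μ w ≠ 0) :
    0 < merit X f F μ w :=
  (norm_pos_iff.2 h).trans_le (norm_H_le_merit X f F μ w)

lemma merit_le_merit_add (hf : IsSelfConcordantBarrier ϑ X f) (hc : IsClosed X)
    (hX : Convex ℝ X) (hne : (interior X).Nonempty) {μ ν : ℝ} (hμ : 0 ≤ μ) (hν : 0 ≤ ν)
    (w : Pair E) : merit X f F μ w ≤ merit X f F ν w + √ϑ * |μ - ν| := by
  have h1 := norm_smoothProj_sub_smoothProj_le hf hc hX hne hμ hν (w.fst - w.snd)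
  have h2 : phi X f μ w = phi X f ν w -
      (smoothProj X f μ (w.fst - w.snd) - smoothProj X f ν (w.fst - w.snd)) := by
    unfold phi
    abel
  have h3 := norm_sub_le (phi X f ν w)
    (smoothProj X f μ (w.fst - w.snd) - smoothProj X f ν (w.fst - w.snd))
  rw [← h2] at h3
  unfold merit
  linarith

lemma continuous_merit (hf : IsSelfConcordantBarrier ϑ X f) (hc : IsClosed X)
    (hX : Convex ℝ X) (hne : (interior X).Nonempty) (hF : Continuous F) {μ : ℝ} (hμ : 0 ≤ μ) :
    Continuous (merit X f F μ) := by
  have := continuous_smoothProj hf hc hX hne hμ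
  unfold merit phi
  fun_prop

lemma solvesVI_of_H_eq_zero (hc : IsClosed X) (hX : Convex ℝ X) (hne : X.Nonempty)
    {v : Pair E} (h : H X f F 0 v = 0) : SolvesVI X F v.fst ∧ v.snd = F v.fst := by
  have h1 : v.fst - proj X (v.fst - v.snd) = 0 := by
    rw [← smoothProj_zero X f]
    exact congrArg WithLp.fst h
  have h2 : F v.fst - v.snd = 0 := congrArg WithLp.snd h
  rw [sub_eq_zero] at h1 h2
  obtain ⟨h3, h4⟩ := proj_spec hc hX hne (v.fst - v.snd)
  rw [← h1] at h3 h4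
  refine ⟨⟨h3, fun y hy => ?_⟩, h2.symm⟩
  have := h4 y hy
  rw [sub_sub_cancel_left, inner_neg_left, ← h2] at this
  linarith

lemma fderiv_H (hf : IsSelfConcordantBarrier ϑ X f) (hc : IsClosed X)
    (hX : Convex ℝ X) (hne : (interior X).Nonempty) (hF : Differentiable ℝ F) {μ : ℝ}
    (hμ : 0 < μ) (w d : Pair E) :
    fderiv ℝ (H X f F μ) w d = WithLp.toLp 2
      (d.fst - fderiv ℝ (smoothProj X f μ) (w.fst - w.snd) (d.fst - d.snd),
        fderiv ℝ F w.fst d.fst - d.snd) := by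
  set e := WithLp.prodContinuousLinearEquiv 2 ℝ E E
  set p₁ : Pair E →L[ℝ] E := (ContinuousLinearMap.fst ℝ E E).comp (e : Pair E →L[ℝ] E × E)
  set p₂ : Pair E →L[ℝ] E := (ContinuousLinearMap.snd ℝ E E).comp (e : Pair E →L[ℝ] E × E)
  have hp := ((contDiff_smoothProj hf hc hX hne hμ).differentiable (by norm_num)
    (w.fst - w.snd)).hasFDerivAt
  have h1 : HasFDerivAt (phi X f μ)
      (p₁ - (fderiv ℝ (smoothProj X f μ) (w.fst - w.snd)).comp (p₁ - p₂)) w :=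
    p₁.hasFDerivAt.sub (HasFDerivAt.comp w (f := fun w : Pair E => w.fst - w.snd) hp
      (p₁ - p₂).hasFDerivAt)
  have h2 : HasFDerivAt (fun w : Pair E => F w.fst - w.snd)
      ((fderiv ℝ F w.fst).comp p₁ - p₂) w :=
    (HasFDerivAt.comp w (f := fun w : Pair E => w.fst) (hF w.fst).hasFDerivAt
      p₁.hasFDerivAt).sub p₂.hasFDerivAt
  have h3 : HasFDerivAt (H X f F μ) _ w :=
    e.symm.hasFDerivAt.comp w (h1.prodMk h2)
  rw [h3.fderiv]
  rfl

/-- Along inexact Newton directions the merit function decreases uniformly. -/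
lemma exists_uniform_decrease (hf : IsSelfConcordantBarrier ϑ X f) (hc : IsClosed X)
    (hX : Convex ℝ X) (hne : (interior X).Nonempty) (hF : Differentiable ℝ F)
    (hF' : HasUniformLittleO F) {κ C β μ₀ : ℝ} (hκ : 0 < κ) (hC : 0 ≤ C) (hβ : 0 ≤ β)
    (hμ₀ : 0 ≤ μ₀) :
    ∃ l₀ : ℝ, 0 < l₀ ∧ l₀ ≤ 1 ∧ ∀ (μ : ℝ) (w d r : Pair E), 0 < μ → μ ≤ μ₀ →
      merit X f F μ w ≤ β * μ → -H X f F μ w + r = fderiv ℝ (H X f F μ) w d →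
      ‖d‖ ≤ C * merit X f F μ w → ∀ l, 0 < l → l ≤ l₀ →
      merit X f F μ (w + l • d) ≤
        (1 - l + κ * l) * merit X f F μ w + l * (‖r.fst‖ + ‖r.snd‖) := by
  obtain ⟨δ, hδ, hFδ⟩ := hF' (κ / (2 * (C + 1))) (by positivity)
  -- The second bound keeps the step within the radius `δ` of the little-o condition. The third
  -- makes the remainder of `p_μ` at most `κ/2 * l * m`. The added `1`s prevent division by zero.
  refine ⟨min 1 (min (δ / (2 * (C * (β * μ₀) + 1))) (κ / (4 * (C ^ 2 * β + 1)))), ?_,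
    min_le_left _ _, ?_⟩
  · have : 0 < C * (β * μ₀) + 1 := by positivity
    positivity
  intro μ w d r hμ hμμ hw heq hd l hl hll
  have hl1 : l ≤ 1 := hll.trans (min_le_left _ _)
  have hl2 : l * (2 * (C * (β * μ₀) + 1)) ≤ δ := (le_div_iff₀ (by positivity)).1
    (hll.trans ((min_le_right _ _).trans (min_le_left _ _)))
  have hl3 : l * (4 * (C ^ 2 * β + 1)) ≤ κ := (le_div_iff₀ (by positivity)).1
    (hll.trans ((min_le_right _ _).trans (min_le_right _ _)))
  rw [fderiv_H hf hc hX hne hF hμ] at heq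
  have heq1 : -phi X f μ w + r.fst =
      d.fst - fderiv ℝ (smoothProj X f μ) (w.fst - w.snd) (d.fst - d.snd) :=
    congrArg WithLp.fst heq
  have heq2 : -(F w.fst - w.snd) + r.snd = fderiv ℝ F w.fst d.fst - d.snd :=
    congrArg WithLp.snd heq
  have hm0 := merit_nonneg X f F μ w
  set m := merit X f F μ w with hm
  have hCm : C * m ≤ C * (β * μ₀) := by gcongr; exact hw.trans (by gcongr)
  have hdf : ‖l • d.fst‖ ≤ l * (C * m) := by
    rw [norm_smul, Real.norm_of_nonneg hl.le]
    gcongr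
    exact (norm_fst_le d).trans hd
  have b2 : ‖F (w.fst + l • d.fst) - (w.snd + l • d.snd)‖ ≤
      (1 - l) * ‖F w.fst - w.snd‖ + l * ‖r.snd‖ + κ / 2 * l * m := by
    have h1 := hFδ w.fst (w.fst + l • d.fst) (by
      rw [add_sub_cancel_left]
      refine hdf.trans_lt ?_
      have : l * (C * m) ≤ l * (C * (β * μ₀)) := by gcongr
      nlinarith [mul_nonneg hC (mul_nonneg hβ hμ₀)])
    rw [add_sub_cancel_left] at h1
    have h2 : κ / (2 * (C + 1)) * ‖l • d.fst‖ ≤ κ / 2 * l * m := by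
      calc κ / (2 * (C + 1)) * ‖l • d.fst‖ ≤ κ / (2 * (C + 1)) * (l * ((C + 1) * m)) := by
            gcongr
            refine hdf.trans ?_
            gcongr
            linarith
        _ = κ / 2 * l * m := by field_simp
    have h3 : F (w.fst + l • d.fst) - (w.snd + l • d.snd) = (1 - l) • (F w.fst - w.snd) +
        l • r.snd + (F (w.fst + l • d.fst) - F w.fst - fderiv ℝ F w.fst (l • d.fst)) := by
      have : r.snd = fderiv ℝ F w.fst d.fst - d.snd + (F w.fst - w.snd) := by
        rw [← heq2]
        abel
      rw [this, map_smul]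
      module
    rw [h3]
    refine (norm_add₃_le).trans ?_
    rw [norm_smul, norm_smul, Real.norm_of_nonneg hl.le, Real.norm_of_nonneg (sub_nonneg.2 hl1)]
    linarith
  have b1 : ‖phi X f μ (w + l • d)‖ ≤
      (1 - l) * ‖phi X f μ w‖ + l * ‖r.fst‖ + κ / 2 * l * m := by
    have h1 := norm_smoothProj_remainder_le hf hc hX hne hμ (w.fst - w.snd)
      (l • (d.fst - d.snd))
    have h2 : ‖l • (d.fst - d.snd)‖ ^ 2 / μ ≤ κ / 2 * l * m := by
      rw [div_le_iff₀ hμ, norm_smul, Real.norm_of_nonneg hl.le, mul_pow]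
      calc l ^ 2 * ‖d.fst - d.snd‖ ^ 2 ≤ l ^ 2 * (2 * (C * m) ^ 2) := by
            gcongr
            exact (norm_fst_sub_snd_sq_le d).trans (by gcongr)
        _ = 2 * l * C ^ 2 * m * l * m := by ring
        -- Here `m ≤ β μ` supplies the factor `μ` that compensates the `1 / μ` of the remainder.
        _ ≤ 2 * l * C ^ 2 * (β * μ) * l * m := by gcongr
        _ = (l * (4 * (C ^ 2 * β))) * (1 / 2 * l * m * μ) := by ring
        _ ≤ κ * (1 / 2 * l * m * μ) := by
            gcongr
            linarith
        _ = κ / 2 * l * m * μ := by ring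
    have h3 : phi X f μ (w + l • d) = (1 - l) • phi X f μ w + l • r.fst -
        (smoothProj X f μ (w.fst - w.snd + l • (d.fst - d.snd)) -
          smoothProj X f μ (w.fst - w.snd) -
          fderiv ℝ (smoothProj X f μ) (w.fst - w.snd) (l • (d.fst - d.snd))) := by
      have : r.fst = d.fst - fderiv ℝ (smoothProj X f μ) (w.fst - w.snd) (d.fst - d.snd) +
          phi X f μ w := by
        rw [← heq1]
        abel
      have h4 : (w + l • d).fst - (w + l • d).snd =
          w.fst - w.snd + l • (d.fst - d.snd) := by
        simp only [WithLp.add_fst, WithLp.add_snd, WithLp.smul_fst, WithLp.smul_snd]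
        module
      rw [this, map_smul, phi, phi, h4, WithLp.add_fst, WithLp.smul_fst]
      module
    rw [h3]
    refine (norm_sub_le _ _).trans ?_
    refine (add_le_add_left (norm_add_le _ _) _).trans ?_
    rw [norm_smul, norm_smul, Real.norm_of_nonneg hl.le, Real.norm_of_nonneg (sub_nonneg.2 hl1)]
    linarith
  have hmw : m = ‖F w.fst - w.snd‖ + ‖phi X f μ w‖ := rfl
  have hml : merit X f F μ (w + l • d) = ‖F (w.fst + l • d.fst) - (w.snd + l • d.snd)‖ +
      ‖phi X f μ (w + l • d)‖ := rfl
  rw [hml]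
  calc _ ≤ (1 - l) * (‖F w.fst - w.snd‖ + ‖phi X f μ w‖) + l * (‖r.fst‖ + ‖r.snd‖) +
        κ * l * m := by linarith
    _ = _ := by rw [← hmw]; ring

end Merit

/-! ### Backtracking searches. -/

section Search

lemma maxPower_spec {α : ℝ} {Q : ℝ → Prop} (h : ∃ j : ℕ, Q (α ^ j)) : Q (maxPower α Q) :=
  Nat.sInf_mem (s := {j : ℕ | Q (α ^ j)}) h

lemma maxPower_mem {α : ℝ} (hα : α ∈ Set.Ioo (0 : ℝ) 1) (Q : ℝ → Prop) :
    maxPower α Q ∈ Set.Ioc (0 : ℝ) 1 :=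
  ⟨pow_pos hα.1 _, pow_le_one₀ hα.1.le hα.2.le⟩

/-- Either there was no backtracking or the preceding trial value failed; an empty search also gives
`1`, as `sInf ∅ = 0`. -/
lemma maxPower_eq_one_or {α : ℝ} (Q : ℝ → Prop) :
    maxPower α Q = 1 ∨ ∃ e : ℝ, maxPower α Q = e * α ∧ ¬ Q e := by
  unfold maxPower
  rcases h : sInf {j : ℕ | Q (α ^ j)} with _ | j
  · exact Or.inl (pow_zero α)
  · refine Or.inr ⟨α ^ j, pow_succ α j, fun hj => ?_⟩
    have := Nat.sInf_le (s := {j : ℕ | Q (α ^ j)}) hj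
    omega

lemma exists_pow_and_le_maxPower {α c : ℝ} (hα : α ∈ Set.Ioo (0 : ℝ) 1) (hc : 0 < c)
    (hc1 : c ≤ 1) {Q : ℝ → Prop} (hQ : ∀ l, 0 < l → l ≤ c → Q l) :
    (∃ j : ℕ, Q (α ^ j)) ∧ α * c ≤ maxPower α Q := by
  constructor
  · obtain ⟨j, hj⟩ := exists_pow_lt_of_lt_one hc hα.2
    exact ⟨j, hQ _ (pow_pos hα.1 j) hj.le⟩
  · rcases maxPower_eq_one_or (α := α) Q with h | ⟨e, he, hQe⟩
    · rw [h]
      exact mul_le_one₀ hα.2.le hc.le hc1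
    · have hm := (maxPower_mem hα Q).1
      rw [he] at hm ⊢
      rw [mul_comm]
      have he0 : 0 < e := pos_of_mul_pos_left hm hα.1.le
      exact mul_le_mul_of_nonneg_right (not_le.1 fun h => hQe (hQ e he0 h)).le hα.1.le

end Search

/-! ### One iteration of the method. -/

section Run

variable {E : Type*} [NormedAddCommGroup E] [InnerProductSpace ℝ E] [FiniteDimensional ℝ E]
  {ϑ : ℝ} {X : Set E} {f : E → ℝ} {F : E → E} {P : Params} {T : Trace E} {N : ℕ∞}

lemma norm_le_of_inexact_newton {V : Type*} [NormedAddCommGroup V] [NormedSpace ℝ V]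
    {A : V →L[ℝ] V} (hA : A.IsInvertible) {C θ : ℝ} (hC : ‖A.inverse‖ ≤ C) (hθ : θ ≤ 1)
    {h r d : V} (heq : -h + r = A d) (hr : ‖r‖ ≤ θ * ‖h‖) : ‖d‖ ≤ 2 * C * ‖h‖ := by
  have hd : d = A.inverse (-h + r) := (hA.inverse_apply_eq.2 heq).symm
  have h1 : ‖-h + r‖ ≤ 2 * ‖h‖ := by
    have := norm_add_le (-h) r
    rw [norm_neg] at this
    nlinarith [norm_nonneg h]
  rw [hd]
  calc ‖A.inverse (-h + r)‖ ≤ ‖A.inverse‖ * ‖-h + r‖ := A.inverse.le_opNorm _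
    _ ≤ C * (2 * ‖h‖) := by gcongr; exact (norm_nonneg _).trans hC
    _ = 2 * C * ‖h‖ := by ring

lemma Params.gammaBar_pos (P : Params) (hβ : √ϑ < P.β) {l : ℝ} (hl : 0 < l) :
    0 < gammaBar ϑ P l := by
  have h1 := Real.sqrt_nonneg ϑ
  have h2 : 0 < P.β := h1.trans_lt hβ
  have h3 := P.σ_mem.1
  unfold gammaBar
  positivity

lemma Params.gammaBar_mul_le (P : Params) (hβ : √ϑ < P.β) (l : ℝ) :
    gammaBar ϑ P l * (P.β + √ϑ) ≤ P.β * P.σ * l := by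
  have h1 := Real.sqrt_nonneg ϑ
  rw [← le_div_iff₀ (by linarith)]
  exact min_le_right _ _

lemma Params.one_sub_gammaBar_mem (P : Params) (hβ : √ϑ < P.β) {l : ℝ} (hl : 0 < l) :
    1 - P.α₂ * gammaBar ϑ P l ∈ Set.Ioo (0 : ℝ) 1 := by
  have h1 := P.gammaBar_pos hβ hl
  have h2 : gammaBar ϑ P l ≤ 1 := min_le_left _ _
  have h3 := P.α₂_mem
  constructor <;> nlinarith [h3.1, h3.2]

/-- `μ` may reach `0` (when `γ = 1`), but then membership in the neighbourhood forces `H_0 = 0` and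
Step 1 terminates. -/
lemma IsIteration.mu_pos {k : ℕ} (hit : IsIteration X f F P T k) (hmu : 0 ≤ T.mu k)
    (hw : T.w k ∈ nbhd X f F P.β (T.mu k)) : 0 < T.mu k := by
  refine hmu.lt_of_ne fun h0 => hit.not_terminated₁ (H_eq_zero_of_merit_nonpos ?_)
  rw [← h0] at hw
  exact hw.trans (mul_zero _).le

/-- The line search succeeds with a step length that is bounded below. -/
lemma exists_lineSearch_bound (hf : IsSelfConcordantBarrier ϑ X f) (hc : IsClosed X)
    (hX : Convex ℝ X) (hne : (interior X).Nonempty) (hF : Differentiable ℝ F)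
    (hF' : HasUniformLittleO F) (hrun : IsRun ϑ X f F P T N)
    (hA : UniformlyNonsingular X f F T N) :
    ∃ l₀ : ℝ, 0 < l₀ ∧ l₀ ≤ 1 ∧ ∀ k : ℕ, (k : ℕ∞) < N → 0 < T.mu k → T.mu k ≤ T.mu 0 →
      T.w k ∈ nbhd X f F P.β (T.mu k) → merit X f F (T.mu k) (T.w k) ≠ 0 →
      (∃ j : ℕ, LineSearchCrit X f F P T k (P.α₁ ^ j)) ∧ P.α₁ * l₀ ≤ T.lam k := by
  obtain ⟨C, hC⟩ := hA
  have hθ : BddAbove (Set.range P.θ₁) := ⟨1, by rintro _ ⟨k, rfl⟩; exact (P.θ₁_mem k).2.le⟩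
  -- `κ` is the slack in the condition on `σ` and `θ₁`. The `√2` pays for passing from the Euclidean
  -- norm of the residual to the sum of component norms.
  have hκ : 0 < 1 - (P.σ + √2 * ⨆ k, P.θ₁ k) := sub_pos.2 P.σ_add_lt
  obtain ⟨l₀, h0, h1, hl₀⟩ := exists_uniform_decrease (C := 2 * max C 0) (β := P.β)
    (μ₀ := T.mu 0) hf hc hX hne hF hF' hκ (by positivity)
    ((Real.sqrt_nonneg ϑ).trans hrun.sqrt_lt_beta.le) hrun.mu_zero_pos.le
  refine ⟨l₀, h0, h1, fun k hk hmu hmu0 hw hm => ?_⟩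
  have hit := hrun.iteration k hk
  obtain ⟨hinv, hnorm⟩ := hC k hk
  have heq := hit.centering_eq hm
  have hr := hit.centering_residual hm
  have hH := norm_H_le_merit X f F (T.mu k) (T.w k)
  have hd : ‖T.dTilde k‖ ≤ 2 * max C 0 * merit X f F (T.mu k) (T.w k) :=
    (norm_le_of_inexact_newton hinv (hnorm.trans (le_max_left C 0)) (P.θ₁_mem k).2.le heq
      hr).trans (by gcongr)
  rw [hit.line_search hm]
  refine exists_pow_and_le_maxPower P.α₁_mem h0 h1 fun l hl hll => ?_
  refine (hl₀ _ _ _ _ hmu hmu0 hw heq hd l hl hll).trans ?_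
  have hres : ‖(T.r₁ k).fst‖ + ‖(T.r₁ k).snd‖ ≤
      √2 * ((⨆ k, P.θ₁ k) * merit X f F (T.mu k) (T.w k)) := by
    refine (norm_fst_add_norm_snd_le _).trans ?_
    gcongr
    refine hr.trans ?_
    have := le_ciSup hθ k
    have h3 := (P.θ₁_mem k).1
    gcongr
    linarith
  have := mul_le_mul_of_nonneg_left hres hl.le
  linarith

/-- The effect of a completed iteration with a successful line search. -/
lemma IsIteration.step {k : ℕ} (hit : IsIteration X f F P T k)
    (hf : IsSelfConcordantBarrier ϑ X f) (hc : IsClosed X) (hX : Convex ℝ X)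
    (hne : (interior X).Nonempty) (hβ : √ϑ < P.β) (hmu : 0 < T.mu k)
    (hw : T.w k ∈ nbhd X f F P.β (T.mu k)) {l : ℝ} (hl : 0 < l) (hl1 : l ≤ 1)
    (hls : merit X f F (T.mu k) (T.w k) ≠ 0 →
      (∃ j : ℕ, LineSearchCrit X f F P T k (P.α₁ ^ j)) ∧ l ≤ T.lam k) :
    (∃ j : ℕ, ReductionCrit X f F P T k (P.α₂ ^ j)) ∧
    (T.wHat k ∈ nbhd X f F P.β (T.muTilde k) →
      ∃ j : ℕ, NewtonReductionCrit X f F P T k (P.α₃ ^ j)) ∧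
    P.α₂ * gammaBar ϑ P l ≤ T.gam k ∧
    T.mu (k + 1) ≤ (1 - P.α₂ * gammaBar ϑ P l) * T.mu k ∧
    0 ≤ T.mu (k + 1) ∧ T.w (k + 1) ∈ nbhd X f F P.β (T.mu (k + 1)) := by
  have hϑ := Real.sqrt_nonneg ϑ
  have hσ := P.σ_mem
  have hβ0 : 0 < P.β := hϑ.trans_lt hβ
  have hg0 := P.gammaBar_pos hβ hl
  have hg1 : gammaBar ϑ P l ≤ 1 := min_le_left _ _
  have hmt : merit X f F (T.mu k) (T.wTilde k) ≤ (1 - P.σ * l) * (P.β * T.mu k) := by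
    by_cases hm : merit X f F (T.mu k) (T.w k) = 0
    · rw [hit.centering_trivial hm, hm]
      have : P.σ * l ≤ 1 := mul_le_one₀ hσ.2.le hl.le hl1
      exact mul_nonneg (sub_nonneg.2 this) (by positivity)
    · obtain ⟨hex, hlam⟩ := hls hm
      have h1 := maxPower_spec hex
      rw [← hit.line_search hm] at h1
      rw [hit.centering_update hm]
      refine h1.trans ?_
      have h2 : T.lam k ≤ 1 := by
        rw [hit.line_search hm]
        exact (maxPower_mem P.α₁_mem _).2
      have h3 : 0 ≤ 1 - P.σ * T.lam k := by nlinarith [hσ.1, hσ.2]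
      refine (mul_le_mul_of_nonneg_left hw h3).trans ?_
      gcongr
      exact hσ.1.le
  -- Reducing `μ` by `g μ` raises the merit by at most `√ϑ g μ`, so `(1 - σ l) β + √ϑ g ≤ β (1 - g)`
  -- suffices; this is the origin of `γ̄`.
  have hred : ∀ g, 0 < g → g ≤ gammaBar ϑ P l → ReductionCrit X f F P T k g := fun g hg hgg => by
    have h1 : 0 ≤ 1 - g := by linarith
    have h2 := merit_le_merit_add (F := F) hf hc hX hne (mul_nonneg h1 hmu.le) hmu.le (T.wTilde k)
    have h3 : |(1 - g) * T.mu k - T.mu k| = g * T.mu k := by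
      rw [show (1 - g) * T.mu k - T.mu k = -(g * T.mu k) by ring, abs_neg,
        abs_of_pos (by positivity)]
    rw [h3] at h2
    have h4 : g * (P.β + √ϑ) ≤ P.β * P.σ * l :=
      (mul_le_mul_of_nonneg_right hgg (by positivity)).trans (P.gammaBar_mul_le hβ l)
    have h5 := mul_le_mul_of_nonneg_right h4 hmu.le
    change merit X f F ((1 - g) * T.mu k) (T.wTilde k) ≤ P.β * ((1 - g) * T.mu k)
    linarith
  obtain ⟨hex, hgam⟩ := exists_pow_and_le_maxPower P.α₂_mem hg0 hg1 hred
  have hcrit := maxPower_spec hex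
  have hgam1 := (maxPower_mem P.α₂_mem (ReductionCrit X f F P T k)).2
  rw [← hit.reduction] at hgam hcrit hgam1
  have ht0 : 0 ≤ T.muTilde k := by
    rw [hit.muTilde_eq]
    exact mul_nonneg (sub_nonneg.2 hgam1) hmu.le
  have ht : T.muTilde k ≤ (1 - P.α₂ * gammaBar ϑ P l) * T.mu k := by
    rw [hit.muTilde_eq]
    gcongr
  have hnewton : T.wHat k ∈ nbhd X f F P.β (T.muTilde k) →
      ∃ j : ℕ, NewtonReductionCrit X f F P T k (P.α₃ ^ j) := fun hacc => by
    -- As `Ψ_0(ŵ) > 0`, the point leaves the neighbourhood of parameter `ν` once `(β + √ϑ) ν <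
    -- Ψ_0(ŵ)`.
    have hpos := merit_pos_of_H_ne_zero (hit.not_terminated₅ hacc)
    have hlim : Tendsto (fun j : ℕ => (P.β + √ϑ) * (P.α₃ ^ j * P.α₃ * T.muTilde k)) atTop
        (𝓝 ((P.β + √ϑ) * (0 * P.α₃ * T.muTilde k))) :=
      (((tendsto_pow_atTop_nhds_zero_of_lt_one P.α₃_mem.1.le P.α₃_mem.2).mul_const _).mul_const
        _).const_mul _
    simp only [zero_mul, mul_zero] at hlim
    obtain ⟨j, hj⟩ := (hlim.eventually_lt_const hpos).exists
    refine ⟨j, fun hmem => ?_⟩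
    have he : 0 ≤ P.α₃ ^ j * P.α₃ * T.muTilde k :=
      mul_nonneg (mul_pos (pow_pos P.α₃_mem.1 j) P.α₃_mem.1).le ht0
    have h1 := merit_le_merit_add (F := F) hf hc hX hne le_rfl he (T.wHat k)
    rw [zero_sub, abs_neg, abs_of_nonneg he] at h1
    change merit X f F _ _ ≤ _ at hmem
    linarith
  refine ⟨hex, hnewton, hgam, ?_⟩
  by_cases hacc : T.wHat k ∈ nbhd X f F P.β (T.muTilde k)
  · obtain ⟨h1, h2⟩ := hit.accepted hacc
    have heta := maxPower_mem P.α₃_mem (NewtonReductionCrit X f F P T k)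
    have hcase := maxPower_eq_one_or (α := P.α₃) (NewtonReductionCrit X f F P T k)
    rw [← hit.newton_reduction hacc] at heta hcase
    rw [h1, h2]
    refine ⟨(mul_le_of_le_one_left ht0 heta.2).trans ht, mul_nonneg heta.1.le ht0, ?_⟩
    -- The extra factor `α₃` in the criterion matters here: failure at the preceding value `e` says
    -- exactly that `ŵ` lies in the neighbourhood for `e * α₃ * μ̃`, the new `μ`.
    rcases hcase with h | ⟨e, he, hQ⟩
    · rwa [h, one_mul]
    · rw [he]
      exact not_not.1 hQ
  · obtain ⟨h1, h2⟩ := hit.rejected hacc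
    rw [h1, h2]
    refine ⟨ht, ht0, ?_⟩
    rw [hit.muTilde_eq]
    exact hcrit

end Run

end NICM

/-! ### Assembly: geometric decay of `μ` and convergence. -/

theorem mainTheorem1 {E : Type*} [NormedAddCommGroup E] [InnerProductSpace ℝ E]
    [FiniteDimensional ℝ E]
    (X : Set E) (hX_closed : IsClosed X) (hX_convex : Convex ℝ X)
    (hX_interior : (interior X).Nonempty)
    (F : E → E) (hF : ContDiff ℝ 1 F)
    (ϑ : ℝ) (f : E → ℝ) (hf : NICM.IsSelfConcordantBarrier ϑ X f)
    (P : NICM.Params) (T : NICM.Trace E) (N : ℕ∞)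
    (hrun : NICM.IsRun ϑ X f F P T N)
    (hA1 : NICM.UniformlyNonsingular X f F T N)
    (hA2 : NICM.HasUniformLittleO F) :
    -- all searches of the algorithm succeed
    (∀ k : ℕ, (k : ℕ∞) < N →
      (NICM.merit X f F (T.mu k) (T.w k) ≠ 0 →
        ∃ j : ℕ, NICM.LineSearchCrit X f F P T k (P.α₁ ^ j)) ∧
      (∃ j : ℕ, NICM.ReductionCrit X f F P T k (P.α₂ ^ j)) ∧
      (T.wHat k ∈ NICM.nbhd X f F P.β (T.muTilde k) →
        ∃ j : ℕ, NICM.NewtonReductionCrit X f F P T k (P.α₃ ^ j))) ∧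
    -- a point at which the algorithm terminates is a solution
    (∀ v : NICM.Pair E, NICM.H X f F 0 v = 0 → NICM.SolvesVI X F v.fst ∧ v.snd = F v.fst) ∧
    -- linear decrease of `μ`
    (∃ lamBar : ℝ, 0 < lamBar ∧ lamBar ≤ 1 ∧
      (∀ k : ℕ, (k : ℕ∞) < N →
        (NICM.merit X f F (T.mu k) (T.w k) ≠ 0 → P.α₁ * lamBar ≤ T.lam k) ∧
        P.α₂ * NICM.gammaBar ϑ P lamBar ≤ T.gam k ∧
        T.mu (k + 1) ≤ (1 - P.α₂ * NICM.gammaBar ϑ P lamBar) * T.mu k) ∧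
      (∀ k : ℕ, (k : ℕ∞) ≤ N →
        T.mu k ≤ T.mu 0 * (1 - P.α₂ * NICM.gammaBar ϑ P lamBar) ^ k)) ∧
    -- convergence of infinite runs
    (N = ⊤ →
      NICM.RLinearTo (fun k => NICM.H X f F 0 (T.w k)) 0 ∧
      CauchySeq T.w ∧
      ∃ wStar : NICM.Pair E, Filter.Tendsto T.w Filter.atTop (nhds wStar) ∧
        NICM.SolvesVI X F wStar.fst ∧ wStar.snd = F wStar.fst) := by
  open NICM in
  have hsolve : ∀ v : Pair E, H X f F 0 v = 0 → SolvesVI X F v.fst ∧ v.snd = F v.fst :=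
    fun v hv => solvesVI_of_H_eq_zero hX_closed hX_convex (hX_interior.mono interior_subset) hv
  have hβ := hrun.sqrt_lt_beta
  have hϑ := Real.sqrt_nonneg ϑ
  have hβ0 : 0 < P.β := hϑ.trans_lt hβ
  obtain ⟨l₀, hl₀, hl₀1, hls⟩ := exists_lineSearch_bound hf hX_closed hX_convex hX_interior
    (hF.differentiable (by norm_num)) hA2 hrun hA1
  obtain ⟨hα0, hα1⟩ := P.α₁_mem
  have hl : 0 < P.α₁ * l₀ := mul_pos hα0 hl₀
  have hl1 : P.α₁ * l₀ ≤ 1 := mul_le_one₀ hα1.le hl₀.le hl₀1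
  obtain ⟨hρ0, hρ1⟩ := P.one_sub_gammaBar_mem hβ hl
  have hstep := fun (k : ℕ) (hk : (k : ℕ∞) < N) (hmu : 0 < T.mu k) (hmu0 : T.mu k ≤ T.mu 0)
      (hw : T.w k ∈ nbhd X f F P.β (T.mu k)) =>
    (hrun.iteration k hk).step hf hX_closed hX_convex hX_interior hβ hmu hw hl hl1
      (hls k hk hmu hmu0 hw)
  set ρ := 1 - P.α₂ * gammaBar ϑ P (P.α₁ * l₀) with hρ
  have hinv : ∀ k : ℕ, (k : ℕ∞) ≤ N → 0 ≤ T.mu k ∧ T.mu k ≤ T.mu 0 * ρ ^ k ∧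
      T.w k ∈ nbhd X f F P.β (T.mu k) := by
    intro k
    induction k with
    | zero => exact fun _ => ⟨hrun.mu_zero_pos.le, by simp, hrun.w_zero_mem⟩
    | succ k ih =>
      intro hk
      have hkN : (k : ℕ∞) < N := lt_of_lt_of_le (by exact_mod_cast k.lt_succ_self) hk
      obtain ⟨h1, h2, h3⟩ := ih hkN.le
      have hpos := (hrun.iteration k hkN).mu_pos h1 h3
      have hle : T.mu k ≤ T.mu 0 := h2.trans
        (mul_le_of_le_one_right hrun.mu_zero_pos.le (pow_le_one₀ hρ0.le hρ1.le))
      obtain ⟨-, -, -, h4, h5, h6⟩ := hstep k hkN hpos hle h3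
      refine ⟨h5, h4.trans ?_, h6⟩
      rw [pow_succ, mul_comm (ρ ^ k), mul_left_comm]
      exact mul_le_mul_of_nonneg_left h2 hρ0.le
  have hpre : ∀ k : ℕ, (k : ℕ∞) < N → 0 < T.mu k ∧ T.mu k ≤ T.mu 0 ∧
      T.w k ∈ nbhd X f F P.β (T.mu k) := fun k hk => by
    obtain ⟨h1, h2, h3⟩ := hinv k hk.le
    exact ⟨(hrun.iteration k hk).mu_pos h1 h3, h2.trans
      (mul_le_of_le_one_right hrun.mu_zero_pos.le (pow_le_one₀ hρ0.le hρ1.le)), h3⟩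
  refine ⟨fun k hk => ?_, hsolve, ⟨P.α₁ * l₀, hl, hl1, fun k hk => ?_, fun k hk => (hinv k hk).2.1⟩,
    fun hN => ?_⟩
  · obtain ⟨h1, h2, h3⟩ := hpre k hk
    obtain ⟨h4, h5, -⟩ := hstep k hk h1 h2 h3
    exact ⟨fun hm => (hls k hk h1 h2 h3 hm).1, h4, h5⟩
  · obtain ⟨h1, h2, h3⟩ := hpre k hk
    obtain ⟨-, -, h4, h5, -⟩ := hstep k hk h1 h2 h3
    exact ⟨fun hm => (mul_le_of_le_one_left hl.le hα1.le).trans (hls k hk h1 h2 h3 hm).2, h4, h5⟩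
  · subst hN
    have hlt : ∀ k : ℕ, (k : ℕ∞) < ⊤ := fun k => ENat.natCast_lt_top k
    have hmerit0 : ∀ k, merit X f F 0 (T.w k) ≤ (P.β + √ϑ) * T.mu k := fun k => by
      obtain ⟨h1, -, h3⟩ := hpre k (hlt k)
      have := merit_le_merit_add (F := F) hf hX_closed hX_convex hX_interior le_rfl h1.le (T.w k)
      rw [zero_sub, abs_neg, abs_of_pos h1] at this
      change merit X f F _ _ ≤ _ at h3
      linarith
    have hmu : ∀ k, T.mu k ≤ T.mu 0 * ρ ^ k := fun k => (hinv k (hlt k).le).2.1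
    have hmerit : ∀ k, merit X f F 0 (T.w k) ≤ (P.β + √ϑ) * T.mu 0 * ρ ^ k := fun k => by
      rw [mul_assoc]
      exact (hmerit0 k).trans (mul_le_mul_of_nonneg_left (hmu k) (by positivity))
    have hcauchy : CauchySeq T.w := by
      obtain ⟨C, hC⟩ := hA1
      refine cauchySeq_of_le_geometric ρ (2 * max C 0 * ((P.β + √ϑ) * T.mu 0)) hρ1 fun k => ?_
      have hit := hrun.iteration k (hlt k)
      obtain ⟨h1, -, h3⟩ := hpre k (hlt k)
      obtain ⟨hA, hnorm⟩ := hC k (hlt k)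
      have hnorm' := hnorm.trans (le_max_left C 0)
      -- Either kind of step has length at most `2 max(C, 0) a`, where `a` is a merit value bounded
      -- by `(β + √ϑ) μ_k`.
      have key : ∀ a, a ≤ (P.β + √ϑ) * T.mu k → 2 * max C 0 * a ≤
          2 * max C 0 * ((P.β + √ϑ) * T.mu 0) * ρ ^ k := fun a ha => by
        rw [mul_assoc (2 * max C 0), mul_assoc (P.β + √ϑ)]
        exact mul_le_mul_of_nonneg_left (ha.trans (mul_le_mul_of_nonneg_left (hmu k)
          (by positivity))) (by positivity)
      rw [dist_eq_norm, norm_sub_rev]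
      by_cases hacc : T.wHat k ∈ nbhd X f F P.β (T.muTilde k)
      · rw [(hit.accepted hacc).2, hit.wHat_eq, add_sub_cancel_left]
        exact (norm_le_of_inexact_newton hA hnorm' (P.θ₂_mem k).2.le hit.newton_eq
          hit.newton_residual).trans (key _ ((norm_H_le_merit X f F 0 _).trans (hmerit0 k)))
      · rw [(hit.rejected hacc).2]
        by_cases hm : merit X f F (T.mu k) (T.w k) = 0
        · rw [hit.centering_trivial hm, sub_self, norm_zero]
          exact (mul_zero (2 * max C 0)).ge.trans (key 0 (by positivity))
        · have hlam := maxPower_mem P.α₁_mem (LineSearchCrit X f F P T k)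
          rw [← hit.line_search hm] at hlam
          rw [hit.centering_update hm, add_sub_cancel_left, norm_smul,
            Real.norm_of_nonneg hlam.1.le]
          refine (mul_le_of_le_one_left (norm_nonneg _) hlam.2).trans ?_
          refine (norm_le_of_inexact_newton hA hnorm' (P.θ₁_mem k).2.le (hit.centering_eq hm)
            (hit.centering_residual hm)).trans (key _ ((norm_H_le_merit X f F _ _).trans ?_))
          change merit X f F _ _ ≤ _ at h3
          nlinarith
    refine ⟨⟨(P.β + √ϑ) * T.mu 0, ρ, hρ0, hρ1, fun k => ?_⟩, hcauchy, ?_⟩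
    · rw [sub_zero]
      exact (norm_H_le_merit X f F 0 _).trans (hmerit k)
    · obtain ⟨wStar, hlim⟩ := cauchySeq_tendsto_of_complete hcauchy
      refine ⟨wStar, hlim, hsolve wStar (H_eq_zero_of_merit_nonpos ?_)⟩
      have h1 := ((continuous_merit hf hX_closed hX_convex hX_interior hF.continuous
        le_rfl).tendsto wStar).comp hlim
      have h2 : Tendsto (fun k => (P.β + √ϑ) * T.mu 0 * ρ ^ k) atTop
          (𝓝 ((P.β + √ϑ) * T.mu 0 * 0)) :=
        (tendsto_pow_atTop_nhds_zero_of_lt_one hρ0.le hρ1).const_mul _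
      rw [mul_zero] at h2
      exact le_of_tendsto_of_tendsto' h1 h2 hmerit
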